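/- **Model.** Let $\mathbb X$ be a finite set and $\{X_t\}_{t\ge 0}$ an irreducible Markov chain on $\mathbb X$ with transition matrix $Q$ (and any initial law). Let $\{H_t\}_{t\ge1}$ be i.i.d. Bernoulli, independent of the chain, with $\Pr[H_t=1]=p_s\in[0,1]$ and $p_f=1-p_s$. At each time $t\ge 1$ a sensor chooses $U_t=\pi_t(X_{0:t},Y_{1:t-1},U_{1:t-1})\in\{0,1\}$; the receiver gets $Y_t=X_t$ if $U_tH_t=1$ and $Y_t=\mathcal E$ (nothing) otherwise, and it knows the initial state, $Y_0=X_0$. The sequence $\pi=(\pi_t)_{t\ge1}$ of arbitrary maps is called a policy. Let $\Theta_t=t-\max\{\tau\le t:Y_\tau\ne\mathcal E\}$ be the age of information and $Z_t=X_{t-\Theta_t}$ the latest received state. The receiver's estimate is $\hat X_t=g(Z_t,\Theta_t)$, where $g(z,\theta)\in\arg\max_{x\in\mathbb X}(Q^{\theta})_{z,x}$, with ties broken by an arbitrary fixed rule. The age of consecutive error is given by $\Delta_0=0$ and, for $t\ge1$, $$\Delta_t=\begin{cases}\Delta_{t-1}+1,& X_t\ne\hat X_t,\ (X_t,\hat X_t)=(X_{t-1},\hat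 X_{t-1}),\\ 1,& X_t\neq\hat X_t,\ (X_t,\hat X_t)\ne(X_{t-1},\hat X_{t-1}),\\ 0,& X_t=\hat X_t.\end{cases}$$ Let $d:\mathbb X\times\mathbb X\to[0,\infty)$, let $\rho:\mathbb N\to[0,\infty)$ be non-decreasing (possibly unbounded), and put $$\mathcal J(\pi)=\limsup_{T\to\infty}\mathbb E^\pi\Big[\frac1T\sum_{t=0}^{T-1}d(X_t,\hat X_t)\rho(\Delta_t)\Big],\qquad F(\pi)=\limsup_{T\to\infty}\mathbb E^\pi\Big[\frac1T\sum_{t=1}^{T}\mathbf 1\{U_t\ne0\}\Big].$$ For $\lambda\ge0$, a policy is $\lambda$-optimal if it attains the minimum of $\mathcal L^\lambda(\pi)=\mathcal J(\pi)+\lambda F(\pi)$ over all policies. Let $F_{\max}\in(0,1]$. **Theorem 1.** Assume that $\lim_{\delta\to\infty}\rho(\delta+1)/\rho(\delta)$ exists and that, for every $i\in\mathbb X$, $$\lim_{\delta\to\infty}\frac{\rho(\delta+1)}{\rho(\delta)}<\frac1{Q_{i,i}\,p_f}\qquad(\text{with }1/0=\infty).$$ (i) For every $\lambda\ge0$ there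 exists a $\lambda$-optimal policy, and every $\lambda$-optimal policy $\pi$ has finite average cost, $\mathcal J(\pi)<\infty$. (ii) There is a $\lambda\ge0$ for which a $\lambda$-optimal policy exists and every $\lambda$-optimal policy $\pi$ is feasible, i.e. $\mathcal J(\pi)<\infty$ and $F(\pi)\le F_{\max}$. -/

import Mathlib

open MeasureTheory Filter Topology
open scoped ENNReal NNReal

noncomputable section

/-- Remote estimation of a finite-state Markov source over an unreliable channel: the data of the
problem with its standing assumptions. -/
structure RemoteEstimation (S : Type*) [Fintype S] [DecidableEq S] where
  /-- transition matrix of the source -/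
  Q : Matrix S S ℝ
  Q_stochastic : Q ∈ Matrix.rowStochastic ℝ S
  Q_irreducible : Q.IsIrreducible
  /-- probability that a transmission attempt succeeds -/
  ps : ℝ
  ps_mem : ps ∈ Set.Icc (0 : ℝ) 1
  /-- the estimate `g z θ` formed when the last received source state is `z`, with age `θ` -/
  g : S → ℕ → S
  /-- `g z θ` is a maximiser of the belief `x ↦ (Q ^ θ) z x` (ties are broken arbitrarily) -/
  g_map : ∀ z θ x, (Q ^ θ) z x ≤ (Q ^ θ) z (g z θ)
  /-- distortion function -/
  d : S → S → ℝ≥0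
  /-- age function -/
  ρ : ℕ → ℝ≥0
  ρ_mono : Monotone ρ

/-- A transmission policy: the rule at time `t ≥ 1` maps the information
`(X_{0:t}, Y_{1:t-1}, U_{1:t-1})` of the sensor to an action (`true` means "transmit").
A channel output is `some x` when the packet `x` is received and `none` when nothing is received.
The rule at `t = 0` is never used. -/
def TransmissionPolicy (S : Type*) : Type _ :=
  (t : ℕ) → (Set.Iic t → S) → (Set.Ioo 0 t → Option S) → (Set.Ioo 0 t → Bool) → Bool

section Paths

variable {S : Type*}

/-- The action `U_t` along a source path `x` and a path `h` of channel states. -/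
def action (π : TransmissionPolicy S) (x : ℕ → S) (h : ℕ → Bool) (t : ℕ) : Bool :=
  π t (fun s => x s)
    (fun s : Set.Ioo 0 t => if (action π x h s && h s) = true then some (x s) else none)
    (fun s : Set.Ioo 0 t => action π x h s)
termination_by t
decreasing_by all_goals exact s.2.2

/-- The channel output `Y_t`. The initial source state is known to the receiver:
`Y_0 = X_0`. -/
def output (π : TransmissionPolicy S) (x : ℕ → S) (h : ℕ → Bool) (t : ℕ) : Option S :=
  if t = 0 ∨ (action π x h t && h t) = true then some (x t) else none

/-- The age of information `Θ_t = t - max {τ ≤ t : Y_τ ≠ ℰ}`. -/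
def ageOfInformation (π : TransmissionPolicy S) (x : ℕ → S) (h : ℕ → Bool) (t : ℕ) : ℕ :=
  t - Nat.findGreatest (fun τ => (output π x h τ).isSome = true) t

/-- The latest received source state `Z_t = X_{t - Θ_t}`. -/
def latestUpdate (π : TransmissionPolicy S) (x : ℕ → S) (h : ℕ → Bool) (t : ℕ) : S :=
  x (t - ageOfInformation π x h t)

/-- The age of consecutive error `Δ_t` of a sequence `xhat` of estimates of the source
path `x`; there is no error at time `0`. -/
def ageOfConsecutiveError [DecidableEq S] (x xhat : ℕ → S) : ℕ → ℕ
  | 0 => 0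
  | t + 1 =>
    if x (t + 1) = xhat (t + 1) then 0
    else if (x (t + 1), xhat (t + 1)) = (x t, xhat t) then ageOfConsecutiveError x xhat t + 1
    else 1

end Paths

namespace RemoteEstimation

variable {S : Type*} [Fintype S] [DecidableEq S] (M : RemoteEstimation S)

/-- The MAP estimate `g (Z_t, Θ_t)` of `X_t`. -/
def estimate (π : TransmissionPolicy S) (x : ℕ → S) (h : ℕ → Bool) (t : ℕ) : S :=
  M.g (latestUpdate π x h t) (ageOfInformation π x h t)

/-- The cost `d (X_t, X̂_t) * ρ (Δ_t)` at time `t`. -/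
def cost (π : TransmissionPolicy S) (x : ℕ → S) (h : ℕ → Bool) (t : ℕ) : ℝ≥0 :=
  M.d (x t) (M.estimate π x h t) * M.ρ (ageOfConsecutiveError x (M.estimate π x h) t)

/-- `X` is a Markov chain with transition matrix `Q` (and any initial law), and `H` is an i.i.d.
Bernoulli sequence with success probability `ps`, independent of `X`: the joint law of
`(X_0, …, X_n, H_1, …, H_n)` is the corresponding product. -/
structure IsSourceAndChannel {Ω : Type*} [MeasurableSpace Ω] (P : Measure Ω)
    (X : ℕ → Ω → S) (H : ℕ → Ω → Bool) : Prop where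
  measurableSet_source : ∀ t i, MeasurableSet {ω | X t ω = i}
  measurableSet_channel : ∀ t b, MeasurableSet {ω | H t ω = b}
  law : ∀ (n : ℕ) (x : ℕ → S) (h : ℕ → Bool),
    P {ω | (∀ t ∈ Finset.Icc 0 n, X t ω = x t) ∧ ∀ t ∈ Finset.Icc 1 n, H t ω = h t} =
      P {ω | X 0 ω = x 0} *
        ENNReal.ofReal ((∏ t ∈ Finset.range n, M.Q (x t) (x (t + 1))) *
          ∏ t ∈ Finset.Icc 1 n, if h t = true then M.ps else 1 - M.ps)

/-- The ratio `ρ (δ + 1) / ρ δ` has a limit, smaller than `1 / (Q i i * p_f)` for every state `i`,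
where `p_f = 1 - p_s` and `1 / 0 = ∞`. -/
def GrowthCondition : Prop :=
  ∃ L : ℝ≥0, Tendsto (fun δ => M.ρ (δ + 1) / M.ρ δ) atTop (𝓝 L) ∧
    ∀ i, (L : ℝ≥0∞) < 1 / ENNReal.ofReal (M.Q i i * (1 - M.ps))

section Criteria

variable {Ω : Type*} [MeasurableSpace Ω] (P : Measure Ω) (X : ℕ → Ω → S) (H : ℕ → Ω → Bool)

/-- The average cost `𝒥(π)`. -/
def averageCost (π : TransmissionPolicy S) : ℝ≥0∞ :=
  limsup (fun T : ℕ => ∫⁻ ω, (T : ℝ≥0∞)⁻¹ *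
    ∑ t ∈ Finset.range T, (M.cost π (fun s => X s ω) (fun s => H s ω) t : ℝ≥0∞) ∂P) atTop

/-- The transmission frequency `F(π)`. -/
def frequency (π : TransmissionPolicy S) : ℝ≥0∞ :=
  limsup (fun T : ℕ => ∫⁻ ω, (T : ℝ≥0∞)⁻¹ *
    ∑ t ∈ Finset.Icc 1 T,
      (if action π (fun s => X s ω) (fun s => H s ω) t = true then 1 else 0) ∂P) atTop

/-- The Lagrangian cost `𝒥(π) + lam * F(π)`. -/
def lagrangian (lam : ℝ≥0) (π : TransmissionPolicy S) : ℝ≥0∞ :=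
  M.averageCost P X H π + lam * frequency P X H π

/-- `π` minimises the Lagrangian cost over all transmission policies. -/
def IsLambdaOptimal (lam : ℝ≥0) (π : TransmissionPolicy S) : Prop :=
  ∀ π' : TransmissionPolicy S, M.lagrangian P X H lam π ≤ M.lagrangian P X H lam π'

/-- `π` has finite average cost and respects the transmission budget. -/
def IsFeasible (Fmax : ℝ) (π : TransmissionPolicy S) : Prop :=
  M.averageCost P X H π < ∞ ∧ frequency P X H π ≤ ENNReal.ofReal Fmax

end Criteria

end RemoteEstimation

end

/-! Finite cost at low frequency. An error can keep ageing only while the source stays put and no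
packet arrives. If old errors trigger transmissions, this survival has probability at most q = max
Q_ii p_f per step. By the growth condition ρ grows eventually at a ratio r with q r < 1, so the
discounted series `ageReserve` converges, and `errorPotential` pays for the survival of the current
error up to a bounded drift (`condNext_cost_le`). Transmitting only after the source has been
constant for N steps therefore has finite average cost. Its frequency is at most (max Q_ii)^N, which
tends to 0 because an irreducible chain with at least two states has no absorbing state
(`exists_rare_policy`).

Existence of a minimiser. If p_s = 0, all policies have the same cost and silence is optimal.
Otherwise take policies whose Lagrangian costs tend to the infimum. Each has a horizon at which its
averages are good and its terminal cost is moderate, and an initial state from which the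
finite-horizon value is no worse than average (`exists_horizon`, `exists_run`). By compactness, a
subsequence has one common initial state i₀ and convergent cost and attempt averages j and f, with j
+ λ f at most the infimum. The two limits are kept apart because 𝒥 and F are separate limsups.

These runs are concatenated: transmit until i₀ is received, play the next run as if time restarted
there, and repeat (`restartPolicy`). A reception erases the error and its age, so a run costs what
it would cost from time 0. Waiting for i₀ has bounded expected length, and its cost is charged to
the terminal cost of the preceding run. Run lengths of order at most the square root of the starting
time leave the averages undisturbed (`exists_policy_of_runs`), so this policy has 𝒥 ≤ j and F ≤ f.

Feasibility. Compare an optimal policy with a policy of finite cost and frequency at most F_max / 2: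
a large λ makes any excess over F_max too expensive. -/

section PathLemmas

/-! ### Causality of path functionals -/

variable {S : Type*}

/-- Two pairs of a source path and a channel path that coincide up to time `n`. -/
def AgreeUpTo (n : ℕ) (x x' : ℕ → S) (h h' : ℕ → Bool) : Prop :=
  -- The channel at time 0 is left out: nothing is sent then, and its law is unspecified.
  (∀ s ≤ n, x s = x' s) ∧ ∀ s, 1 ≤ s → s ≤ n → h s = h' s

/-- A path functional that is determined by the paths up to time `n`. -/
def DependsUpTo {α : Type*} (n : ℕ) (F : (ℕ → S) → (ℕ → Bool) → α) : Prop :=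
  ∀ ⦃x x' h h'⦄, AgreeUpTo n x x' h h' → F x h = F x' h'

lemma AgreeUpTo.mono {m n : ℕ} (hmn : m ≤ n) {x x' : ℕ → S} {h h' : ℕ → Bool}
    (H : AgreeUpTo n x x' h h') : AgreeUpTo m x x' h h' :=
  ⟨fun s hs => H.1 s (hs.trans hmn), fun s h1 hs => H.2 s h1 (hs.trans hmn)⟩

lemma AgreeUpTo.shift {r n : ℕ} {x x' : ℕ → S} {h h' : ℕ → Bool}
    (H : AgreeUpTo (r + n) x x' h h') :
    AgreeUpTo n (fun s => x (r + s)) (fun s => x' (r + s)) (fun s => h (r + s))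
      (fun s => h' (r + s)) :=
  ⟨fun s hs => H.1 _ (by omega), fun s h1 hs => H.2 _ (by omega) (by omega)⟩

lemma agreeUpTo_update {n m : ℕ} (hmn : m < n) (x : ℕ → S) (h : ℕ → Bool) (j : S) (b : Bool) :
    AgreeUpTo m (Function.update x n j) x (Function.update h n b) h :=
  ⟨fun s hs => Function.update_of_ne (by omega) _ _,
    fun s _ hs => Function.update_of_ne (by omega) _ _⟩

lemma DependsUpTo.update {α : Type*} {m n : ℕ} (hmn : m < n) {F : (ℕ → S) → (ℕ → Bool) → α}
    (hF : DependsUpTo m F) (x : ℕ → S) (h : ℕ → Bool) (j : S) (b : Bool) :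
    F (Function.update x n j) (Function.update h n b) = F x h :=
  hF (agreeUpTo_update hmn x h j b)

lemma DependsUpTo.comp₂ {α β γ : Type*} {n : ℕ} {F : (ℕ → S) → (ℕ → Bool) → α}
    {G : (ℕ → S) → (ℕ → Bool) → β} (f : α → β → γ) (hF : DependsUpTo n F)
    (hG : DependsUpTo n G) : DependsUpTo n (fun x h => f (F x h) (G x h)) :=
  fun _ _ _ _ H => by simp only [hF H, hG H]

lemma dependsUpTo_const {α : Type*} (n : ℕ) (a : α) :
    DependsUpTo n (fun (_ : ℕ → S) (_ : ℕ → Bool) => a) := fun _ _ _ _ _ => rfl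

lemma dependsUpTo_source {α : Type*} {m n : ℕ} (hmn : m ≤ n) (f : S → α) :
    DependsUpTo n (fun (x : ℕ → S) (_ : ℕ → Bool) => f (x m)) :=
  fun _ _ _ _ H => by simp only [H.1 m hmn]

variable (π : TransmissionPolicy S)

lemma dependsUpTo_action (t : ℕ) : DependsUpTo t (fun x h => action π x h t) := by
  induction t using Nat.strong_induction_on with
  | _ t ih =>
    intro x x' h h' H
    have key : ∀ s : Set.Ioo 0 t, action π x h s = action π x' h' s := fun s =>
      ih s s.2.2 (H.mono s.2.2.le)
    show action π x h t = action π x' h' t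
    rw [action, action]
    congr 1
    · funext s; exact H.1 s s.2
    · funext s
      rw [key s, H.2 s s.2.1 s.2.2.le, H.1 s s.2.2.le]
    · funext s; exact key s

lemma dependsUpTo_output (t : ℕ) : DependsUpTo t (fun x h => output π x h t) := by
  intro x x' h h' H
  simp only [output]
  rcases Nat.eq_zero_or_pos t with rfl | ht
  · simp [H.1 0 le_rfl]
  · have e : action π x h t = action π x' h' t := dependsUpTo_action π t H
    rw [e, H.1 t le_rfl, H.2 t ht le_rfl]

lemma dependsUpTo_ageOfInformation (t : ℕ) :
    DependsUpTo t (fun x h => ageOfInformation π x h t) := by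
  intro x x' h h' H
  simp only [ageOfInformation]
  congr 1
  have : ∀ m ≤ t, Nat.findGreatest (fun τ => (output π x h τ).isSome = true) m =
      Nat.findGreatest (fun τ => (output π x' h' τ).isSome = true) m := by
    intro m
    induction m with
    | zero => intro _; rfl
    | succ m ih =>
      intro hm
      have e : output π x h (m + 1) = output π x' h' (m + 1) :=
        dependsUpTo_output π (m + 1) (H.mono hm)
      rw [Nat.findGreatest_succ, Nat.findGreatest_succ, ih (by omega), e]
  exact this t le_rfl

lemma dependsUpTo_latestUpdate (t : ℕ) :
    DependsUpTo t (fun x h => latestUpdate π x h t) := by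
  intro x x' h h' H
  simp only [latestUpdate]
  have e : ageOfInformation π x h t = ageOfInformation π x' h' t :=
    dependsUpTo_ageOfInformation π t H
  rw [e, H.1 _ (Nat.sub_le _ _)]

lemma ageOfConsecutiveError_congr [DecidableEq S] {x x' e e' : ℕ → S} {t : ℕ}
    (hx : ∀ s ≤ t, x s = x' s) (he : ∀ s ≤ t, e s = e' s) :
    ageOfConsecutiveError x e t = ageOfConsecutiveError x' e' t := by
  induction t with
  | zero => rfl
  | succ t ih =>
    simp only [ageOfConsecutiveError]
    rw [ih (fun s hs => hx s (by omega)) (fun s hs => he s (by omega)), hx _ le_rfl,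
      he _ le_rfl, hx t (by omega), he t (by omega)]

/-- An age of consecutive error larger than `k` forces the source to be constant
during the last `k` steps. -/
lemma source_const_of_lt_age [DecidableEq S] {x e : ℕ → S} {t k : ℕ}
    (hk : k < ageOfConsecutiveError x e t) : k < t ∧ ∀ s, s ≤ t → t ≤ s + k → x s = x t := by
  induction t generalizing k with
  | zero => simp [ageOfConsecutiveError] at hk
  | succ t ih =>
    simp only [ageOfConsecutiveError] at hk
    split_ifs at hk with h1 h2
    · omega
    · rw [Prod.mk.injEq] at h2
      rcases Nat.eq_zero_or_pos k with rfl | hk0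
      · refine ⟨by omega, fun s h3 h4 => ?_⟩
        rw [show s = t + 1 by omega]
      · obtain ⟨h5, h6⟩ := ih (k := k - 1) (by omega)
        refine ⟨by omega, fun s h3 h4 => ?_⟩
        rcases Nat.lt_or_ge t s with h7 | h7
        · rw [show s = t + 1 by omega]
        · rw [h6 s h7 (by omega), h2.1]
    · refine ⟨by omega, fun s h3 h4 => ?_⟩
      rw [show s = t + 1 by omega]

/-- Once `p` holds at `r`, earlier times no longer matter. With `p` the receptions, ages after a
reception can be computed on the shifted path. -/
lemma findGreatest_add {p : ℕ → Prop} [DecidablePred p] {r : ℕ} (hr : p r) (k : ℕ) :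
    Nat.findGreatest p (r + k) = r + Nat.findGreatest (fun s => p (r + s)) k := by
  induction k with
  | zero =>
    have := Nat.findGreatest_eq (P := p) (n := r) hr
    simpa using this
  | succ k ih =>
    rw [← add_assoc, Nat.findGreatest_succ, Nat.findGreatest_succ, ih]
    simp only [← add_assoc]
    split_ifs <;> rfl

lemma output_zero (x : ℕ → S) (h : ℕ → Bool) : output π x h 0 = some (x 0) := by simp [output]

lemma ageOfInformation_eq_zero {x : ℕ → S} {h : ℕ → Bool} {t : ℕ}
    (ht : (output π x h t).isSome = true) : ageOfInformation π x h t = 0 := by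
  rw [ageOfInformation, Nat.findGreatest_eq (P := fun τ => (output π x h τ).isSome = true) ht,
    Nat.sub_self]

lemma ageOfInformation_le (x : ℕ → S) (h : ℕ → Bool) (t : ℕ) :
    ageOfInformation π x h t ≤ t := Nat.sub_le _ _

lemma output_eq_some {x : ℕ → S} {h : ℕ → Bool} {t : ℕ}
    (ht : (output π x h t).isSome = true) : output π x h t = some (x t) := by
  simp only [output] at *
  split_ifs at * <;> simp_all

end PathLemmas

/-! ### Renewal at receptions -/

namespace RemoteEstimation

variable {S : Type*} [Fintype S] [DecidableEq S] (M : RemoteEstimation S)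
  (π : TransmissionPolicy S)

/-- `Q ^ 0` is the identity, whose row has a unique maximiser. Hence a reception removes the error
whatever the tie-breaking rule. -/
lemma g_zero (z : S) : M.g z 0 = z := by
  have := M.g_map z 0 z
  simp only [pow_zero, Matrix.one_apply_eq] at this
  by_contra hne
  rw [Matrix.one_apply_ne (Ne.symm hne)] at this
  linarith

lemma dependsUpTo_estimate (t : ℕ) : DependsUpTo t (fun x h => M.estimate π x h t) :=
  (dependsUpTo_latestUpdate π t).comp₂ M.g (dependsUpTo_ageOfInformation π t)

/-- The age of consecutive error under a policy. -/
def errorAge (x : ℕ → S) (h : ℕ → Bool) (t : ℕ) : ℕ :=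
  ageOfConsecutiveError x (M.estimate π x h) t

lemma dependsUpTo_errorAge (t : ℕ) : DependsUpTo t (fun x h => M.errorAge π x h t) :=
  fun _ _ _ _ H => ageOfConsecutiveError_congr H.1
    fun s hs => M.dependsUpTo_estimate π s (H.mono hs)

lemma cost_eq (x : ℕ → S) (h : ℕ → Bool) (t : ℕ) :
    M.cost π x h t = M.d (x t) (M.estimate π x h t) * M.ρ (M.errorAge π x h t) := rfl

lemma dependsUpTo_cost (t : ℕ) : DependsUpTo t (fun x h => (M.cost π x h t : ℝ≥0∞)) := by
  intro x x' h h' H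
  have h1 : M.estimate π x h t = M.estimate π x' h' t := M.dependsUpTo_estimate π t H
  have h2 : M.errorAge π x h t = M.errorAge π x' h' t := M.dependsUpTo_errorAge π t H
  simp only [cost_eq, h1, h2, H.1 t le_rfl]

variable {π}

lemma estimate_eq_of_isSome {x : ℕ → S} {h : ℕ → Bool} {t : ℕ}
    (ht : (output π x h t).isSome = true) : M.estimate π x h t = x t := by
  rw [estimate, latestUpdate, ageOfInformation_eq_zero π ht, g_zero, Nat.sub_zero]

lemma errorAge_eq_zero_of_isSome {x : ℕ → S} {h : ℕ → Bool} {t : ℕ}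
    (ht : (output π x h t).isSome = true) : M.errorAge π x h t = 0 := by
  cases t with
  | zero => rfl
  | succ t => simp [errorAge, ageOfConsecutiveError, M.estimate_eq_of_isSome ht]

/-- After a reception at time `r`, estimates and error ages are those of the shifted paths,
as long as the outputs are. -/
lemma estimate_shift {π' : TransmissionPolicy S} {x : ℕ → S} {h : ℕ → Bool} {r n : ℕ}
    (hout : ∀ k ≤ n, output π x h (r + k) =
      output π' (fun s => x (r + s)) (fun s => h (r + s)) k) {k : ℕ} (hk : k ≤ n) :
    M.estimate π x h (r + k) = M.estimate π' (fun s => x (r + s)) (fun s => h (r + s)) k := by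
  have hr : (output π x h r).isSome = true := by
    have := hout 0 (Nat.zero_le _)
    rw [output_zero] at this
    simp only [add_zero] at this
    simp [this]
  have hage : ageOfInformation π x h (r + k) =
      ageOfInformation π' (fun s => x (r + s)) (fun s => h (r + s)) k := by
    have h1 := findGreatest_add (p := fun τ => (output π x h τ).isSome = true) hr k
    have h2 : ∀ m ≤ k, Nat.findGreatest (fun s => (output π x h (r + s)).isSome = true) m =
        Nat.findGreatest (fun s => (output π' (fun s => x (r + s)) (fun s => h (r + s))
          s).isSome = true) m := by
      intro m
      induction m with
      | zero => intro _; rfl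
      | succ m ih =>
        intro hm
        rw [Nat.findGreatest_succ, Nat.findGreatest_succ, ih (by omega),
          hout (m + 1) (by omega)]
    simp only [ageOfInformation]
    rw [h1, h2 k le_rfl]
    omega
  have hle := ageOfInformation_le π' (fun s => x (r + s)) (fun s => h (r + s)) k
  simp only [estimate, latestUpdate, hage]
  rw [Nat.add_sub_assoc hle]

/-- A reception resets the error age to 0, which is also its initial value. From there both ages
obey the same recursion with the same data. -/
lemma errorAge_shift {π' : TransmissionPolicy S} {x : ℕ → S} {h : ℕ → Bool} {r n : ℕ}
    (hout : ∀ k ≤ n, output π x h (r + k) =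
      output π' (fun s => x (r + s)) (fun s => h (r + s)) k) {k : ℕ} (hk : k ≤ n) :
    M.errorAge π x h (r + k) = M.errorAge π' (fun s => x (r + s)) (fun s => h (r + s)) k := by
  have hr : (output π x h r).isSome = true := by
    have := hout 0 (Nat.zero_le _)
    rw [output_zero] at this
    simp only [add_zero] at this
    simp [this]
  induction k with
  | zero => exact M.errorAge_eq_zero_of_isSome hr
  | succ k ih =>
    have h1 := M.estimate_shift hout hk
    have h2 := M.estimate_shift hout (k := k) (by omega)
    have h3 := ih (by omega)
    simp only [errorAge] at h3 ⊢
    rw [← add_assoc] at h1 ⊢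
    simp only [ageOfConsecutiveError]
    rw [h3, h1, h2]
    simp only [add_assoc]

lemma cost_shift {π' : TransmissionPolicy S} {x : ℕ → S} {h : ℕ → Bool} {r n : ℕ}
    (hout : ∀ k ≤ n, output π x h (r + k) =
      output π' (fun s => x (r + s)) (fun s => h (r + s)) k) {k : ℕ} (hk : k ≤ n) :
    M.cost π x h (r + k) = M.cost π' (fun s => x (r + s)) (fun s => h (r + s)) k := by
  rw [cost_eq, cost_eq, M.errorAge_shift hout hk, M.estimate_shift hout hk]

end RemoteEstimation

/-! ### Markov property and drift inequality -/

namespace RemoteEstimation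

variable {S : Type*} [Fintype S] [DecidableEq S] (M : RemoteEstimation S)

/-- Transition probabilities of the source. -/
noncomputable def trans (i j : S) : ℝ≥0∞ := ENNReal.ofReal (M.Q i j)

/-- Law of the channel state. -/
noncomputable def channel (b : Bool) : ℝ≥0∞ :=
  ENNReal.ofReal (if b = true then M.ps else 1 - M.ps)

lemma sum_trans (i : S) : ∑ j, M.trans i j = 1 := by
  simp only [trans]
  rw [← ENNReal.ofReal_sum_of_nonneg fun j _ => M.Q_stochastic.1 i j,
    Matrix.sum_row_of_mem_rowStochastic M.Q_stochastic, ENNReal.ofReal_one]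

lemma sum_channel : ∑ b, M.channel b = 1 := by
  have h := M.ps_mem
  simp only [channel, Fintype.sum_bool, if_true, Bool.false_eq_true, if_false]
  rw [← ENNReal.ofReal_add h.1 (by linarith [h.2])]
  simp

/-- One-step conditional expectation, given the paths up to time `t`, of a functional of the
paths up to time `t + 1`. -/
noncomputable def condNext (t : ℕ) (F : (ℕ → S) → (ℕ → Bool) → ℝ≥0∞) (x : ℕ → S)
    (h : ℕ → Bool) : ℝ≥0∞ :=
  ∑ j, ∑ b, M.trans (x t) j * M.channel b *
    F (Function.update x (t + 1) j) (Function.update h (t + 1) b)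

variable {M}

lemma condNext_mono {t : ℕ} {F G : (ℕ → S) → (ℕ → Bool) → ℝ≥0∞} {x : ℕ → S} {h : ℕ → Bool}
    (hFG : ∀ j b, F (Function.update x (t + 1) j) (Function.update h (t + 1) b) ≤
      G (Function.update x (t + 1) j) (Function.update h (t + 1) b)) :
    M.condNext t F x h ≤ M.condNext t G x h :=
  Finset.sum_le_sum fun j _ => Finset.sum_le_sum fun b _ => mul_le_mul_right (hFG j b) _

lemma condNext_add (t : ℕ) (F G : (ℕ → S) → (ℕ → Bool) → ℝ≥0∞) (x : ℕ → S) (h : ℕ → Bool) :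
    M.condNext t (fun x h => F x h + G x h) x h = M.condNext t F x h + M.condNext t G x h := by
  simp only [condNext, mul_add, Finset.sum_add_distrib]

lemma condNext_const (t : ℕ) (a : ℝ≥0∞) (x : ℕ → S) (h : ℕ → Bool) :
    M.condNext t (fun _ _ => a) x h = a := by
  simp only [condNext]
  simp_rw [← Finset.sum_mul, ← Finset.mul_sum]
  rw [M.sum_channel]
  simp [M.sum_trans]

lemma dependsUpTo_condNext {t : ℕ} {F : (ℕ → S) → (ℕ → Bool) → ℝ≥0∞}
    (hF : DependsUpTo (t + 1) F) : DependsUpTo t (M.condNext t F) := by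
  intro x x' h h' H
  simp only [condNext]
  rw [H.1 t le_rfl]
  refine Finset.sum_congr rfl fun j _ => Finset.sum_congr rfl fun b _ => ?_
  congr 1
  refine hF ⟨fun s hs => ?_, fun s h1 hs => ?_⟩
  · rcases eq_or_ne s (t + 1) with rfl | hne
    · simp
    · rw [Function.update_of_ne hne, Function.update_of_ne hne, H.1 s (by omega)]
  · rcases eq_or_ne s (t + 1) with rfl | hne
    · simp
    · rw [Function.update_of_ne hne, Function.update_of_ne hne, H.2 s h1 (by omega)]

section Expectation

variable {Ω : Type*} [MeasurableSpace Ω] {P : Measure Ω} {X : ℕ → Ω → S} {H : ℕ → Ω → Bool}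

/-- The source path up to time `n` and the channel path on `[1, n]`. -/
def pathPrefix (X : ℕ → Ω → S) (H : ℕ → Ω → Bool) (n : ℕ) (ω : Ω) :
    (Finset.Icc 0 n → S) × (Finset.Icc 1 n → Bool) :=
  (fun s => X s ω, fun s => H s ω)

/-- A source path with a given beginning. -/
def extendSource {n : ℕ} (e : Finset.Icc 0 n → S) (s : ℕ) : S :=
  -- Values after `n` are immaterial, since the functionals summed over prefixes depend only on
  -- times up to `n`; `e 0` avoids choosing a default state.
  if hs : s ∈ Finset.Icc 0 n then e ⟨s, hs⟩ else e ⟨0, by simp⟩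

/-- A channel path with a given beginning. -/
def extendChannel {n : ℕ} (e : Finset.Icc 1 n → Bool) (s : ℕ) : Bool :=
  if hs : s ∈ Finset.Icc 1 n then e ⟨s, hs⟩ else false

set_option linter.unusedSectionVars false in
lemma pathPrefix_eq_iff {n : ℕ} {ω : Ω} {e : (Finset.Icc 0 n → S) × (Finset.Icc 1 n → Bool)} :
    pathPrefix X H n ω = e ↔ (∀ t ∈ Finset.Icc 0 n, X t ω = extendSource e.1 t) ∧
      ∀ t ∈ Finset.Icc 1 n, H t ω = extendChannel e.2 t := by
  constructor
  · rintro rfl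
    refine ⟨fun t ht => ?_, fun t ht => ?_⟩
    · simp only [extendSource, dif_pos ht, pathPrefix]
    · simp only [extendChannel, dif_pos ht, pathPrefix]
  · rintro ⟨h1, h2⟩
    refine Prod.ext (funext fun s => ?_) (funext fun s => ?_)
    · have := h1 s s.2
      simp only [extendSource, dif_pos s.2] at this
      exact this
    · have := h2 s s.2
      simp only [extendChannel, dif_pos s.2] at this
      exact this

lemma measurableSet_pathPrefix (hXH : M.IsSourceAndChannel P X H) (n : ℕ)
    (e : (Finset.Icc 0 n → S) × (Finset.Icc 1 n → Bool)) :
    MeasurableSet {ω | pathPrefix X H n ω = e} := by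
  simp only [pathPrefix_eq_iff, Set.ofPred_and, Set.ofPred_forall]
  exact (Finset.measurableSet_biInter _ fun t _ => hXH.measurableSet_source t _).inter
    (Finset.measurableSet_biInter _ fun t _ => hXH.measurableSet_channel t _)

lemma eq_sum_indicator {n : ℕ} {G : (ℕ → S) → (ℕ → Bool) → ℝ≥0∞} (hG : DependsUpTo n G)
    (ω : Ω) : G (fun s => X s ω) (fun s => H s ω) =
      ∑ e, {ω | pathPrefix X H n ω = e}.indicator
        (fun _ => G (extendSource e.1) (extendChannel e.2)) ω := by
  rw [Finset.sum_eq_single (pathPrefix X H n ω)]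
  · rw [Set.indicator_of_mem (by simp)]
    obtain ⟨h1, h2⟩ := pathPrefix_eq_iff.1 (rfl : pathPrefix X H n ω = pathPrefix X H n ω)
    exact hG ⟨fun s hs => h1 s (by simp [hs]), fun s h3 hs => h2 s (by simp [h3, hs])⟩
  · intro e _ hne
    exact Set.indicator_of_notMem (by simpa using hne.symm) _
  · simp

lemma measurable_of_depends (hXH : M.IsSourceAndChannel P X H) {n : ℕ}
    {G : (ℕ → S) → (ℕ → Bool) → ℝ≥0∞} (hG : DependsUpTo n G) :
    Measurable fun ω => G (fun s => X s ω) (fun s => H s ω) := by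
  simp_rw [eq_sum_indicator hG]
  exact Finset.measurable_fun_sum _ fun e _ =>
    measurable_const.indicator (measurableSet_pathPrefix hXH n e)

lemma setLIntegral_eq_sum (hXH : M.IsSourceAndChannel P X H) {n : ℕ}
    {G : (ℕ → S) → (ℕ → Bool) → ℝ≥0∞} (hG : DependsUpTo n G) (B : Set Ω) :
    ∫⁻ ω in B, G (fun s => X s ω) (fun s => H s ω) ∂P =
      ∑ e, G (extendSource e.1) (extendChannel e.2) *
        P ({ω | pathPrefix X H n ω = e} ∩ B) := by
  simp_rw [eq_sum_indicator hG]
  rw [lintegral_finsetSum _ fun e _ =>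
    measurable_const.indicator (measurableSet_pathPrefix hXH n e)]
  refine Finset.sum_congr rfl fun e _ => ?_
  rw [lintegral_indicator_const (measurableSet_pathPrefix hXH n e),
    Measure.restrict_apply (measurableSet_pathPrefix hXH n e)]

/-- The joint law is a product, so one more step multiplies the probability of a prefix by one
transition factor and one channel factor. -/
lemma measure_prefix_inter (hXH : M.IsSourceAndChannel P X H) (n : ℕ)
    (e : (Finset.Icc 0 n → S) × (Finset.Icc 1 n → Bool)) (j : S) (b : Bool) :
    P ({ω | pathPrefix X H n ω = e} ∩ {ω | X (n + 1) ω = j ∧ H (n + 1) ω = b}) =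
      M.trans (extendSource e.1 n) j * M.channel b * P {ω | pathPrefix X H n ω = e} := by
  set x := extendSource e.1
  set h := extendChannel e.2
  have hset : {ω | pathPrefix X H n ω = e} ∩ {ω | X (n + 1) ω = j ∧ H (n + 1) ω = b} =
      {ω | (∀ t ∈ Finset.Icc 0 (n + 1), X t ω = Function.update x (n + 1) j t) ∧
        ∀ t ∈ Finset.Icc 1 (n + 1), H t ω = Function.update h (n + 1) b t} := by
    ext ω
    simp only [Set.mem_inter_iff, Set.mem_ofPred_eq, pathPrefix_eq_iff]
    constructor
    · rintro ⟨⟨h1, h2⟩, h3, h4⟩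
      refine ⟨fun t ht => ?_, fun t ht => ?_⟩
      · rcases eq_or_ne t (n + 1) with rfl | hne
        · simpa using h3
        · rw [Function.update_of_ne hne]
          simp only [Finset.mem_Icc] at ht h1
          exact h1 t ⟨ht.1, by omega⟩
      · rcases eq_or_ne t (n + 1) with rfl | hne
        · simpa using h4
        · rw [Function.update_of_ne hne]
          simp only [Finset.mem_Icc] at ht h2
          exact h2 t ⟨ht.1, by omega⟩
    · rintro ⟨h1, h2⟩
      simp only [Finset.mem_Icc] at h1 h2
      refine ⟨⟨fun t ht => ?_, fun t ht => ?_⟩, ?_, ?_⟩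
      · simp only [Finset.mem_Icc] at ht
        rw [h1 t ⟨ht.1, by omega⟩, Function.update_of_ne (by omega)]
      · simp only [Finset.mem_Icc] at ht
        rw [h2 t ⟨ht.1, by omega⟩, Function.update_of_ne (by omega)]
      · simpa using h1 (n + 1) (by omega)
      · simpa using h2 (n + 1) (by omega)
  have hset' : {ω | pathPrefix X H n ω = e} = {ω | (∀ t ∈ Finset.Icc 0 n, X t ω = x t) ∧
      ∀ t ∈ Finset.Icc 1 n, H t ω = h t} := by
    ext ω
    exact pathPrefix_eq_iff
  rw [hset, hset', hXH.law, hXH.law, Finset.prod_range_succ,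
    Finset.prod_Icc_succ_top (by omega)]
  have e1 : ∏ t ∈ Finset.range n, M.Q (Function.update x (n + 1) j t)
      (Function.update x (n + 1) j (t + 1)) = ∏ t ∈ Finset.range n, M.Q (x t) (x (t + 1)) := by
    refine Finset.prod_congr rfl fun t ht => ?_
    rw [Finset.mem_range] at ht
    rw [Function.update_of_ne (by omega), Function.update_of_ne (by omega)]
  have e2 : (∏ t ∈ Finset.Icc 1 n, if Function.update h (n + 1) b t = true then M.ps
      else 1 - M.ps) = ∏ t ∈ Finset.Icc 1 n, if h t = true then M.ps else 1 - M.ps := by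
    refine Finset.prod_congr rfl fun t ht => ?_
    rw [Finset.mem_Icc] at ht
    rw [Function.update_of_ne (by omega)]
  rw [e1, e2, Function.update_of_ne (by omega), Function.update_of_ne (by omega),
    Function.update_self, Function.update_self]
  have hps := M.ps_mem
  have n1 : 0 ≤ ∏ t ∈ Finset.range n, M.Q (x t) (x (t + 1)) :=
    Finset.prod_nonneg fun t _ => M.Q_stochastic.1 _ _
  have n2 : 0 ≤ M.Q (x n) j := M.Q_stochastic.1 _ _
  have n3 : 0 ≤ (if b = true then M.ps else 1 - M.ps) := by
    split_ifs
    · exact hps.1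
    · linarith [hps.2]
  simp only [trans, channel]
  rw [ENNReal.ofReal_mul (mul_nonneg n1 n2), ENNReal.ofReal_mul n1, ENNReal.ofReal_mul' n3,
    ENNReal.ofReal_mul n1]
  ring

/-- The Markov property of the source and the independence of the channel. -/
lemma lintegral_condNext (hXH : M.IsSourceAndChannel P X H) {n : ℕ}
    {F : (ℕ → S) → (ℕ → Bool) → ℝ≥0∞} (hF : DependsUpTo (n + 1) F) :
    ∫⁻ ω, M.condNext n F (fun s => X s ω) (fun s => H s ω) ∂P =
      ∫⁻ ω, F (fun s => X s ω) (fun s => H s ω) ∂P := by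
  have hG : ∀ j b, DependsUpTo n
      (fun x h => F (Function.update x (n + 1) j) (Function.update h (n + 1) b)) := by
    intro j b x x' h h' A
    refine hF ⟨fun s hs => ?_, fun s h1 hs => ?_⟩
    · rcases eq_or_ne s (n + 1) with rfl | hne
      · simp
      · rw [Function.update_of_ne hne, Function.update_of_ne hne, A.1 s (by omega)]
    · rcases eq_or_ne s (n + 1) with rfl | hne
      · simp
      · rw [Function.update_of_ne hne, Function.update_of_ne hne, A.2 s h1 (by omega)]
  have hT : ∀ j b, DependsUpTo n (fun x h => M.trans (x n) j * M.channel b *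
      F (Function.update x (n + 1) j) (Function.update h (n + 1) b)) := fun j b =>
    (dependsUpTo_source le_rfl fun i => M.trans i j * M.channel b).comp₂ (· * ·) (hG j b)
  have hmeas : ∀ j b, MeasurableSet {ω | X (n + 1) ω = j ∧ H (n + 1) ω = b} := fun j b =>
    (hXH.measurableSet_source _ j).inter (hXH.measurableSet_channel _ b)
  -- With the step-`n + 1` values frozen, the integrand depends on the prefix only; weighting by the
  -- transition and channel probabilities then amounts to restricting to the event that these values
  -- occur.
  have key : ∀ j b, ∫⁻ ω, M.trans (X n ω) j * M.channel b *
      F (Function.update (fun s => X s ω) (n + 1) j)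
        (Function.update (fun s => H s ω) (n + 1) b) ∂P =
      ∫⁻ ω in {ω | X (n + 1) ω = j ∧ H (n + 1) ω = b},
        F (Function.update (fun s => X s ω) (n + 1) j)
          (Function.update (fun s => H s ω) (n + 1) b) ∂P := by
    intro j b
    have h1 := setLIntegral_eq_sum hXH (hT j b) Set.univ
    rw [setLIntegral_univ] at h1
    rw [h1, setLIntegral_eq_sum hXH (hG j b)]
    refine Finset.sum_congr rfl fun e _ => ?_
    rw [measure_prefix_inter hXH, Set.inter_univ]
    ring
  have hsplit : ∀ ω, F (fun s => X s ω) (fun s => H s ω) =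
      ∑ j, ∑ b, {ω | X (n + 1) ω = j ∧ H (n + 1) ω = b}.indicator
        (fun ω => F (Function.update (fun s => X s ω) (n + 1) j)
          (Function.update (fun s => H s ω) (n + 1) b)) ω := by
    intro ω
    rw [Finset.sum_eq_single (X (n + 1) ω), Finset.sum_eq_single (H (n + 1) ω)]
    · rw [Set.indicator_of_mem (by simp)]
      congr 1
      · exact (Function.update_eq_self (n + 1) (fun s => X s ω)).symm
      · exact (Function.update_eq_self (n + 1) (fun s => H s ω)).symm
    · intro b _ hne
      exact Set.indicator_of_notMem (by simpa using hne.symm) _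
    · simp
    · intro j _ hne
      refine Finset.sum_eq_zero fun b _ => ?_
      refine Set.indicator_of_notMem ?_ _
      simp only [Set.mem_ofPred_eq, not_and]
      exact fun h => absurd h.symm hne
    · simp
  simp_rw [hsplit]
  simp only [condNext]
  rw [lintegral_finsetSum _ fun j _ => Finset.measurable_fun_sum _ fun b _ =>
      measurable_of_depends hXH (hT j b),
    lintegral_finsetSum _ fun j _ => Finset.measurable_fun_sum _ fun b _ =>
      (measurable_of_depends hXH (hG j b)).indicator (hmeas j b)]
  refine Finset.sum_congr rfl fun j _ => ?_
  rw [lintegral_finsetSum _ fun b _ => measurable_of_depends hXH (hT j b),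
    lintegral_finsetSum _ fun b _ => (measurable_of_depends hXH (hG j b)).indicator (hmeas j b)]
  refine Finset.sum_congr rfl fun b _ => ?_
  rw [key, lintegral_indicator (hmeas j b)]

/-- A drift inequality bounds the expected total cost. -/
lemma sum_lintegral_le_of_drift (hXH : M.IsSourceAndChannel P X H) [IsProbabilityMeasure P]
    {c Ψ : ℕ → (ℕ → S) → (ℕ → Bool) → ℝ≥0∞} {b : ℝ≥0∞} {T : ℕ}
    (hc : ∀ t, DependsUpTo t (c t)) (hΨ : ∀ t, DependsUpTo t (Ψ t))
    (hdrift : ∀ t < T, ∀ x h, M.condNext t (fun x h => c (t + 1) x h + Ψ (t + 1) x h) x h ≤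
      Ψ t x h + b) :
    ∑ t ∈ Finset.Icc 1 T, ∫⁻ ω, c t (fun s => X s ω) (fun s => H s ω) ∂P +
      ∫⁻ ω, Ψ T (fun s => X s ω) (fun s => H s ω) ∂P ≤
      ∫⁻ ω, Ψ 0 (fun s => X s ω) (fun s => H s ω) ∂P + T * b := by
  induction T with
  | zero => simp
  | succ T ih =>
    have h1 := ih fun t ht => hdrift t (by omega)
    have h2 : ∫⁻ ω, c (T + 1) (fun s => X s ω) (fun s => H s ω) ∂P +
        ∫⁻ ω, Ψ (T + 1) (fun s => X s ω) (fun s => H s ω) ∂P ≤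
        ∫⁻ ω, Ψ T (fun s => X s ω) (fun s => H s ω) ∂P + b := by
      rw [← lintegral_add_left (measurable_of_depends hXH (hc (T + 1))),
        ← lintegral_condNext hXH (F := fun x h => c (T + 1) x h + Ψ (T + 1) x h)
          ((hc (T + 1)).comp₂ (· + ·) (hΨ (T + 1)))]
      refine (lintegral_mono fun ω => hdrift T (by omega) _ _).trans ?_
      rw [lintegral_add_right _ measurable_const]
      simp
    rw [Finset.sum_Icc_succ_top (by omega)]
    calc _ = (∑ t ∈ Finset.Icc 1 T, ∫⁻ ω, c t (fun s => X s ω) (fun s => H s ω) ∂P) +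
          (∫⁻ ω, c (T + 1) (fun s => X s ω) (fun s => H s ω) ∂P +
          ∫⁻ ω, Ψ (T + 1) (fun s => X s ω) (fun s => H s ω) ∂P) := by ring
      _ ≤ (∑ t ∈ Finset.Icc 1 T, ∫⁻ ω, c t (fun s => X s ω) (fun s => H s ω) ∂P) +
          (∫⁻ ω, Ψ T (fun s => X s ω) (fun s => H s ω) ∂P + b) := by gcongr
      _ ≤ _ := by
        rw [← add_assoc]
        refine (add_le_add_left h1 b).trans (le_of_eq ?_)
        push_cast
        ring

end Expectation

end RemoteEstimation

/-! ### A potential for the error age -/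

namespace RemoteEstimation

variable {S : Type*} [Fintype S] [DecidableEq S] (M : RemoteEstimation S)

/-- The largest probability that the source stays put while a transmission fails. -/
noncomputable def stickiness : ℝ≥0∞ := ⨆ i, M.trans i i * M.channel false

/-- Discounted future age costs when the error age keeps growing from `δ`. -/
noncomputable def ageReserve (δ : ℕ) : ℝ≥0∞ :=
  ∑' m : ℕ, M.stickiness ^ (m + 1) * (M.ρ (δ + 1 + m) : ℝ≥0∞)

/-- The reason for the definition of the reserve: if an error survives with probability at most
`stickiness`, the current reserve pays for its next cost and its next reserve. -/
lemma ageReserve_step (δ : ℕ) :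
    M.stickiness * ((M.ρ (δ + 1) : ℝ≥0∞) + M.ageReserve (δ + 1)) = M.ageReserve δ := by
  have h0 : M.ageReserve δ = _ := tsum_eq_zero_add' ENNReal.summable
  rw [h0, ageReserve, mul_add, ← ENNReal.tsum_mul_left]
  congr 1
  · simp
  · refine tsum_congr fun m => ?_
    rw [show δ + 1 + (m + 1) = δ + 1 + 1 + m by ring]
    ring

lemma ageReserve_mono : Monotone M.ageReserve := fun a b hab =>
  ENNReal.tsum_le_tsum fun m => mul_le_mul_right
    (ENNReal.coe_le_coe.2 (M.ρ_mono (by omega))) _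

variable {M}

/-- At a state attaining `stickiness`, the growth condition leaves room for some `r` strictly
between `L` and the inverse of `stickiness`. -/
lemma GrowthCondition.exists_ratio [Nonempty S] (hρ : M.GrowthCondition) :
    ∃ r : ℝ≥0, M.stickiness * r < 1 ∧ ∃ δ₀, ∀ δ, δ₀ ≤ δ → M.ρ (δ + 1) ≤ r * M.ρ δ := by
  obtain ⟨L, hL, hlt⟩ := hρ
  obtain ⟨i, hi⟩ := exists_eq_ciSup_of_finite (f := fun i => M.trans i i * M.channel false)
  have hq : M.stickiness = ENNReal.ofReal (M.Q i i * (1 - M.ps)) := by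
    rw [stickiness, ← hi, ENNReal.ofReal_mul (M.Q_stochastic.1 _ _)]
    simp [trans, channel]
  have h1 := hlt i
  rw [← hq] at h1
  obtain ⟨r, hr1, hr2⟩ := ENNReal.lt_iff_exists_nnreal_btwn.1 h1
  refine ⟨r, ?_, ?_⟩
  · rw [mul_comm]
    rcases eq_or_ne M.stickiness 0 with h0 | h0
    · simp [h0]
    · have hfin : M.stickiness ≠ ∞ := by rw [hq]; exact ENNReal.ofReal_ne_top
      exact (ENNReal.lt_div_iff_mul_lt (Or.inl h0) (Or.inl hfin)).1 hr2
  · have h2 : ∀ᶠ δ in atTop, M.ρ (δ + 1) / M.ρ δ < r :=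
      hL.eventually_lt_const (ENNReal.coe_lt_coe.1 hr1)
    obtain ⟨δ₁, hδ₁⟩ := eventually_atTop.1 h2
    -- Where `ρ` vanishes the quotient is 0 by convention and says nothing, so the ratio is used
    -- only past a point where `ρ` is positive.
    by_cases hz : ∀ δ, M.ρ δ = 0
    · exact ⟨0, fun δ _ => by simp [hz]⟩
    · push Not at hz
      obtain ⟨δ₂, hδ₂⟩ := hz
      refine ⟨max δ₁ δ₂, fun δ hδ => ?_⟩
      have hpos : 0 < M.ρ δ :=
        (pos_iff_ne_zero.2 hδ₂).trans_le (M.ρ_mono ((le_max_right _ _).trans hδ))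
      exact ((div_lt_iff₀ hpos).1 (hδ₁ δ ((le_max_left _ _).trans hδ))).le

/-- Eventually `ρ (δ + m)` is at most `r ^ m * ρ δ`, so a geometric series of ratio `stickiness * r`
dominates the reserve; the finitely many small ages are absorbed by the constant. -/
lemma GrowthCondition.exists_ageReserve_le [Nonempty S] (hρ : M.GrowthCondition) :
    ∃ C : ℝ≥0, ∀ δ, M.ageReserve δ ≤ C * (1 + M.ρ δ) := by
  obtain ⟨r, hr, δ₀, hδ₀⟩ := hρ.exists_ratio
  have hpow : ∀ δ, δ₀ ≤ δ → ∀ m, M.ρ (δ + m) ≤ r ^ m * M.ρ δ := by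
    intro δ hδ m
    induction m with
    | zero => simp
    | succ m ih =>
      calc M.ρ (δ + m + 1) ≤ r * M.ρ (δ + m) := hδ₀ _ (by omega)
        _ ≤ r * (r ^ m * M.ρ δ) := by gcongr
        _ = _ := by ring
  have hall : ∀ δ m, M.ρ (δ + m) ≤ r ^ m * (M.ρ δ₀ + M.ρ δ) := by
    intro δ m
    rcases le_total δ₀ δ with h | h
    · refine (hpow δ h m).trans ?_
      gcongr
      exact le_add_of_nonneg_left zero_le
    · refine ((M.ρ_mono (by omega)).trans (hpow δ₀ le_rfl m)).trans ?_
      gcongr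
      exact le_add_of_nonneg_right zero_le
  set A : ℝ≥0∞ := ∑' m : ℕ, (M.stickiness * r) ^ (m + 1) with hA
  have hAfin : A ≠ ∞ := by
    have : A ≤ ∑' m : ℕ, (M.stickiness * r) ^ m :=
      ENNReal.tsum_le_tsum fun m => pow_le_pow_right_of_le_one' hr.le (Nat.le_succ m)
    rw [ENNReal.tsum_geometric] at this
    refine ne_top_of_le_ne_top ?_ this
    rw [Ne, ENNReal.inv_eq_top, tsub_eq_zero_iff_le, not_le]
    exact hr
  lift A to ℝ≥0 using hAfin with a ha
  refine ⟨a * (1 + M.ρ δ₀), fun δ => ?_⟩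
  calc M.ageReserve δ ≤ ∑' m : ℕ, (M.stickiness * r) ^ (m + 1) * (M.ρ δ₀ + M.ρ δ) := by
        refine ENNReal.tsum_le_tsum fun m => ?_
        rw [mul_pow, mul_assoc]
        gcongr
        rw [add_assoc, add_comm 1 m]
        exact_mod_cast hall δ (m + 1)
    _ = a * (M.ρ δ₀ + M.ρ δ) := by rw [ENNReal.tsum_mul_right, ← hA]
    _ ≤ a * ((1 + M.ρ δ₀) * (1 + M.ρ δ)) := by
        gcongr
        calc (M.ρ δ₀ : ℝ≥0∞) + M.ρ δ ≤ (M.ρ δ₀ + M.ρ δ) + (1 + M.ρ δ₀ * M.ρ δ) :=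
              le_add_of_nonneg_right zero_le
          _ = _ := by ring
    _ = _ := by push_cast; ring

variable (M)

/-- An upper bound for the distortion. -/
def maxDistortion : ℝ≥0 := ∑ i, ∑ j, M.d i j

lemma d_le_maxDistortion (i j : S) : M.d i j ≤ M.maxDistortion :=
  (Finset.single_le_sum (f := fun j => M.d i j) (fun _ _ => zero_le) (Finset.mem_univ j)).trans
    (Finset.single_le_sum (f := fun i => ∑ j, M.d i j) (fun _ _ => zero_le) (Finset.mem_univ i))

/-- Potential of the current error: expected future cost of its persistence. -/
noncomputable def errorPotential (π : TransmissionPolicy S) (x : ℕ → S) (h : ℕ → Bool) (t : ℕ) :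
    ℝ≥0∞ :=
  M.d (x t) (M.estimate π x h t) * M.ageReserve (M.errorAge π x h t)

/-- Largest cost plus potential at an error age of at most `n`. -/
noncomputable def costBound (n : ℕ) : ℝ≥0∞ :=
  M.maxDistortion * (M.ρ n + M.ageReserve n)

lemma costBound_mono : Monotone M.costBound := fun a b hab => by
  have := M.ageReserve_mono hab
  have := M.ρ_mono hab
  simp only [costBound]
  gcongr

lemma dependsUpTo_errorPotential (π : TransmissionPolicy S) (t : ℕ) :
    DependsUpTo t (fun x h => M.errorPotential π x h t) := by
  intro x x' h h' H
  have h1 : M.estimate π x h t = M.estimate π x' h' t := M.dependsUpTo_estimate π t H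
  have h2 : M.errorAge π x h t = M.errorAge π x' h' t := M.dependsUpTo_errorAge π t H
  simp only [errorPotential, h1, h2, H.1 t le_rfl]

variable {M} {π : TransmissionPolicy S}

lemma errorPotential_shift {π' : TransmissionPolicy S} {x : ℕ → S} {h : ℕ → Bool} {r n : ℕ}
    (hout : ∀ k ≤ n, output π x h (r + k) =
      output π' (fun s => x (r + s)) (fun s => h (r + s)) k) {k : ℕ} (hk : k ≤ n) :
    M.errorPotential π x h (r + k) =
      M.errorPotential π' (fun s => x (r + s)) (fun s => h (r + s)) k := by
  simp only [errorPotential, M.errorAge_shift hout hk, M.estimate_shift hout hk]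

lemma cost_add_errorPotential_le {x : ℕ → S} {h : ℕ → Bool} {t n : ℕ}
    (hn : M.errorAge π x h t ≤ n) :
    (M.cost π x h t : ℝ≥0∞) + M.errorPotential π x h t ≤ M.costBound n := by
  refine le_trans ?_ (M.costBound_mono hn)
  simp only [cost_eq, errorPotential, costBound, ENNReal.coe_mul, ← mul_add]
  gcongr
  exact M.d_le_maxDistortion _ _

lemma errorAge_succ_cases (x : ℕ → S) (h : ℕ → Bool) (t : ℕ) :
    M.errorAge π x h (t + 1) ≤ 1 ∨ (x (t + 1) = x t ∧
      M.estimate π x h (t + 1) = M.estimate π x h t ∧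
      x (t + 1) ≠ M.estimate π x h (t + 1) ∧
      M.errorAge π x h (t + 1) = M.errorAge π x h t + 1) := by
  simp only [errorAge, ageOfConsecutiveError]
  split_ifs with h1 h2
  · exact Or.inl (Nat.zero_le _)
  · rw [Prod.mk.injEq] at h2
    exact Or.inr ⟨h2.1, h2.2, h1, rfl⟩
  · exact Or.inl le_rfl

/-- Either the error age falls to at most 1, where cost and potential are bounded, or the same error
persists. The latter forces the source to stay and the packet not to arrive, since a reception would
erase the error. -/
lemma cost_add_errorPotential_succ_le (x : ℕ → S) (h : ℕ → Bool) (t : ℕ) :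
    (M.cost π x h (t + 1) : ℝ≥0∞) + M.errorPotential π x h (t + 1) ≤ M.costBound 1 +
      if x (t + 1) = x t ∧ (action π x h (t + 1) && h (t + 1)) = false then
        M.d (x t) (M.estimate π x h t) * (M.ρ (M.errorAge π x h t + 1) +
          M.ageReserve (M.errorAge π x h t + 1)) else 0 := by
  rcases M.errorAge_succ_cases (π := π) x h t with h1 | ⟨h1, h2, h3, h4⟩
  · exact (cost_add_errorPotential_le h1).trans (le_add_of_nonneg_right zero_le)
  · have h5 : (action π x h (t + 1) && h (t + 1)) = false := by
      by_contra h6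
      rw [Bool.not_eq_false] at h6
      exact h3 (M.estimate_eq_of_isSome (by simp [output, h6])).symm
    rw [if_pos ⟨h1, h5⟩]
    refine le_add_of_nonneg_of_le zero_le ?_
    simp only [cost_eq, errorPotential, h4, h2, h1, ENNReal.coe_mul, ← mul_add]
    exact le_rfl

/-- If persistent errors of age at least `N` trigger a transmission, then the error potential
drifts upwards by at most a constant. -/
lemma condNext_cost_le {x : ℕ → S} {h : ℕ → Bool} {t N : ℕ}
    (hU : N ≤ M.errorAge π x h t → ∀ b, action π (Function.update x (t + 1) (x t))
      (Function.update h (t + 1) b) (t + 1) = true) :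
    M.condNext t (fun x h => (M.cost π x h (t + 1) : ℝ≥0∞) + M.errorPotential π x h (t + 1)) x h ≤
      M.errorPotential π x h t + M.costBound (N + 1) := by
  have hx : ∀ j, Function.update x (t + 1) j t = x t := fun j =>
    Function.update_of_ne (by omega) _ _
  have hage : ∀ j b, M.errorAge π (Function.update x (t + 1) j) (Function.update h (t + 1) b) t =
      M.errorAge π x h t := (M.dependsUpTo_errorAge π t).update (Nat.lt_succ_self t) x h
  have hest : ∀ j b, M.estimate π (Function.update x (t + 1) j) (Function.update h (t + 1) b) t =
      M.estimate π x h t := (M.dependsUpTo_estimate π t).update (Nat.lt_succ_self t) x h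
  rcases Nat.lt_or_ge (M.errorAge π x h t) N with hlt | hge
  -- Below age `N` the next age is at most `N + 1` whatever the action, so a constant suffices.
  · rw [add_comm (M.errorPotential π x h t)]
    refine le_trans ?_ (le_add_of_nonneg_right zero_le)
    rw [← M.condNext_const t (M.costBound (N + 1)) x h]
    refine condNext_mono fun j b => cost_add_errorPotential_le ?_
    rcases M.errorAge_succ_cases (π := π) (Function.update x (t + 1) j)
      (Function.update h (t + 1) b) t with h1 | ⟨_, _, _, h4⟩
    · omega
    · rw [h4, hage]; omega
  -- From age `N` on, staying put triggers a transmission, so persistence also needs a channel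
  -- failure and has probability at most `stickiness`; `ageReserve_step` then closes the bound.
  · set G : ℝ≥0∞ := M.d (x t) (M.estimate π x h t) * (M.ρ (M.errorAge π x h t + 1) +
      M.ageReserve (M.errorAge π x h t + 1)) with hG
    have hbound : ∀ j b, (M.cost π (Function.update x (t + 1) j)
          (Function.update h (t + 1) b) (t + 1) : ℝ≥0∞) +
        M.errorPotential π (Function.update x (t + 1) j) (Function.update h (t + 1) b) (t + 1) ≤
        M.costBound 1 + if j = x t ∧ b = false then G else 0 := by
      intro j b
      refine (cost_add_errorPotential_succ_le _ _ t).trans ?_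
      rw [hage, hest, hx, Function.update_self, Function.update_self]
      gcongr
      split_ifs with h1 h2 h2
      · exact le_rfl
      · exfalso
        obtain ⟨rfl, h3⟩ := h1
        rw [hU hge b, Bool.true_and] at h3
        exact h2 ⟨rfl, h3⟩
      · exact zero_le
      · exact le_rfl
    calc _ ≤ ∑ j, ∑ b, M.trans (x t) j * M.channel b *
          (M.costBound 1 + if j = x t ∧ b = false then G else 0) :=
          Finset.sum_le_sum fun j _ => Finset.sum_le_sum fun b _ =>
            mul_le_mul_right (hbound j b) _
      _ = M.costBound 1 + M.trans (x t) (x t) * M.channel false * G := by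
          have h1 := M.condNext_const t (M.costBound 1) x h
          simp only [condNext] at h1
          simp_rw [mul_add, Finset.sum_add_distrib, h1]
          congr 1
          rw [Finset.sum_eq_single (x t) (by intro j _ hj; simp [hj]) (by simp)]
          simp
      _ ≤ M.costBound (N + 1) + M.stickiness * G := by
          gcongr
          · exact M.costBound_mono (by omega)
          · exact le_iSup (fun i => M.trans i i * M.channel false) (x t)
      _ = M.errorPotential π x h t + M.costBound (N + 1) := by
          rw [add_comm, hG, errorPotential, ← M.ageReserve_step (M.errorAge π x h t),
            mul_left_comm]

lemma GrowthCondition.ageReserve_ne_top [Nonempty S] (hρ : M.GrowthCondition) (δ : ℕ) :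
    M.ageReserve δ ≠ ∞ := by
  obtain ⟨C, hC⟩ := hρ.exists_ageReserve_le
  exact ne_top_of_le_ne_top (by finiteness) (hC δ)

lemma GrowthCondition.costBound_ne_top [Nonempty S] (hρ : M.GrowthCondition) (n : ℕ) :
    M.costBound n ≠ ∞ := by
  have := hρ.ageReserve_ne_top n
  simp only [costBound]
  finiteness

/-- One constant serves all policies, so the potential left at the end of a run can be charged to
the cost of its last step. -/
lemma GrowthCondition.exists_errorPotential_le [Nonempty S] (hρ : M.GrowthCondition) :
    ∃ C : ℝ≥0, ∀ (π : TransmissionPolicy S) x h t,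
      M.errorPotential π x h t ≤ C * (1 + M.cost π x h t) := by
  obtain ⟨C, hC⟩ := hρ.exists_ageReserve_le
  refine ⟨C * (1 + M.maxDistortion), fun π x h t => ?_⟩
  have h1 := hC (M.errorAge π x h t)
  have h2 : (M.d (x t) (M.estimate π x h t) : ℝ≥0∞) ≤ M.maxDistortion :=
    ENNReal.coe_le_coe.2 (M.d_le_maxDistortion _ _)
  rw [errorPotential, cost_eq]
  push_cast
  calc _ ≤ (M.d (x t) (M.estimate π x h t) : ℝ≥0∞) * (C * (1 + M.ρ (M.errorAge π x h t))) := by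
        gcongr
    _ = C * (M.d (x t) (M.estimate π x h t) +
        M.d (x t) (M.estimate π x h t) * M.ρ (M.errorAge π x h t)) := by ring
    _ ≤ C * (M.maxDistortion + M.d (x t) (M.estimate π x h t) * M.ρ (M.errorAge π x h t)) := by
        gcongr
    _ ≤ C * ((1 + M.maxDistortion) *
        (1 + M.d (x t) (M.estimate π x h t) * M.ρ (M.errorAge π x h t))) := by
        gcongr
        generalize (M.d (x t) (M.estimate π x h t) : ℝ≥0∞) * M.ρ (M.errorAge π x h t) = y
        calc (M.maxDistortion : ℝ≥0∞) + y ≤ (M.maxDistortion + y) + (1 + M.maxDistortion * y) :=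
              le_add_of_nonneg_right zero_le
          _ = _ := by ring
    _ = _ := by ring

end RemoteEstimation

/-! ### Restarting policies -/

section Restart

variable {S : Type*} [DecidableEq S]

/-- Phases of a restarting policy, as a function of the channel outputs: `none` while waiting for
the source state `i₀` to be received, `some r` during the run of length `len r` that starts with
the reception of `i₀` at time `r`. -/
def restartPhase (i₀ : S) (len : ℕ → ℕ) (y : ℕ → Option S) : ℕ → Option ℕ
  | 0 => none
  | t + 1 =>
    match restartPhase i₀ len y t with
    | none => if y (t + 1) = some i₀ then some (t + 1) else none
    -- The action at `t + 1` is governed by the phase at `t`, so a run has exactly `len r` actions,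
    -- at times `r + 1` to `r + len r`. A reception at its last time does not open a new run.
    | some r => if t + 1 < r + len r then some r else none

/-- The policy that transmits until the source state `i₀` is received, at time `r` say, then
follows the policy `pol r` for `len r` steps as if it started at time `r`, and so on. -/
def restartPolicy (i₀ : S) (len : ℕ → ℕ) (pol : ℕ → TransmissionPolicy S) :
    TransmissionPolicy S := fun t x y u =>
  match restartPhase i₀ len (fun s => if hs : s ∈ Set.Ioo 0 t then y ⟨s, hs⟩ else none) (t - 1) with
  | none => true
  -- The `min` only serves the type: `s ≤ t - r` already gives `r + s ≤ t`, since an active run has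
  -- `r ≤ t - 1`.
  | some r => pol r (t - r) (fun s => x ⟨min (r + s) t, Set.mem_Iic.2 (min_le_right _ _)⟩)
      (fun s => y ⟨r + s, by have h1 := s.2.1; have h2 := s.2.2; constructor <;> omega⟩)
      (fun s => u ⟨r + s, by have h1 := s.2.1; have h2 := s.2.2; constructor <;> omega⟩)

variable {i₀ : S} {len : ℕ → ℕ} {pol : ℕ → TransmissionPolicy S}

lemma restartPhase_congr {y y' : ℕ → Option S} {t : ℕ} (hy : ∀ s, 1 ≤ s → s ≤ t → y s = y' s) :
    restartPhase i₀ len y t = restartPhase i₀ len y' t := by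
  induction t with
  | zero => rfl
  | succ t ih =>
    simp only [restartPhase]
    rw [ih fun s h1 hs => hy s h1 (by omega), hy (t + 1) (by omega) le_rfl]

lemma restartPhase_eq_some (hlen : ∀ r, 1 ≤ len r) {y : ℕ → Option S} {t r : ℕ}
    (hr : restartPhase i₀ len y t = some r) :
    1 ≤ r ∧ r ≤ t ∧ t < r + len r ∧ y r = some i₀ ∧
      ∀ s, r ≤ s → s ≤ t → restartPhase i₀ len y s = some r := by
  induction t with
  | zero => simp [restartPhase] at hr
  | succ t ih =>
    have hr' := hr
    simp only [restartPhase] at hr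
    split at hr
    · split_ifs at hr with h1
      obtain rfl : t + 1 = r := by simpa using hr
      refine ⟨by omega, le_rfl, by have := hlen (t + 1); omega, h1, fun s h2 h3 => ?_⟩
      rwa [le_antisymm h3 h2]
    · rename_i r' h2
      split_ifs at hr with h1
      obtain rfl : r' = r := by simpa using hr
      obtain ⟨h3, h4, _, h6, h7⟩ := ih h2
      refine ⟨h3, by omega, h1, h6, fun s h8 h9 => ?_⟩
      rcases Nat.lt_or_ge t s with h10 | h10
      · rwa [show s = t + 1 by omega]
      · exact h7 s h8 h10

/-- The restarted rule reads the actions recorded during the run. Strong induction shows that they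
are those it would have taken on the shifted path. -/
lemma action_restartPolicy (hlen : ∀ r, 1 ≤ len r) (x : ℕ → S) (h : ℕ → Bool) (t : ℕ) :
    action (restartPolicy i₀ len pol) x h (t + 1) =
      match restartPhase i₀ len (output (restartPolicy i₀ len pol) x h) t with
      | none => true
      | some r => action (pol r) (fun s => x (r + s)) (fun s => h (r + s)) (t + 1 - r) := by
  induction t using Nat.strong_induction_on with
  | _ t ih =>
    have hph : restartPhase i₀ len (fun s => if hs : s ∈ Set.Ioo 0 (t + 1) then
        (if (action (restartPolicy i₀ len pol) x h s && h s) = true then some (x s) else none)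
        else none) t = restartPhase i₀ len (output (restartPolicy i₀ len pol) x h) t := by
      refine restartPhase_congr fun s h1 hs => ?_
      rw [dif_pos (show s ∈ Set.Ioo 0 (t + 1) from ⟨by omega, by omega⟩)]
      simp only [output, show s ≠ 0 by omega, false_or]
    rw [action]
    conv_lhs => unfold restartPolicy
    simp only [Nat.add_sub_cancel]
    change (match restartPhase i₀ len (fun s => if hs : s ∈ Set.Ioo 0 (t + 1) then
        (if (action (restartPolicy i₀ len pol) x h s && h s) = true then some (x s) else none)
        else none) t with
      | none => true
      | some r => pol r (t + 1 - r) (fun s => x (min (r + s) (t + 1)))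
        (fun s => if (action (restartPolicy i₀ len pol) x h (r + s) && h (r + s)) = true
          then some (x (r + s)) else none)
        (fun s => action (restartPolicy i₀ len pol) x h (r + s))) = _
    rw [hph]
    cases hr : restartPhase i₀ len (output (restartPolicy i₀ len pol) x h) t with
    | none => rfl
    | some r =>
      obtain ⟨h1, h2, h3, h4, h5⟩ := restartPhase_eq_some hlen hr
      have key : ∀ s : Set.Ioo 0 (t + 1 - r), action (restartPolicy i₀ len pol) x h (r + s) =
          action (pol r) (fun s => x (r + s)) (fun s => h (r + s)) s := by
        intro s
        have hs1 := s.2.1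
        have hs2 := s.2.2
        have := ih (r + s - 1) (by omega)
        rw [h5 (r + s - 1) (by omega) (by omega), Nat.sub_add_cancel (by omega)] at this
        rw [this]
        simp only [Nat.add_sub_cancel_left]
      simp only
      conv_rhs => rw [action]
      congr 1
      · funext s
        have hs : (s : ℕ) ≤ t + 1 - r := s.2
        rw [min_eq_left (by omega)]
      · funext s
        rw [key s]
      · funext s
        exact key s

/-- During a run, the outputs are those of the restarted policy on the shifted paths. -/
lemma output_restartPolicy (hlen : ∀ r, 1 ≤ len r) {x : ℕ → S} {h : ℕ → Bool} {t r : ℕ}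
    (hr : restartPhase i₀ len (output (restartPolicy i₀ len pol) x h) t = some r) :
    ∀ k ≤ t + 1 - r, output (restartPolicy i₀ len pol) x h (r + k) =
      output (pol r) (fun s => x (r + s)) (fun s => h (r + s)) k := by
  intro k hk
  obtain ⟨h1, h2, h3, h4, h5⟩ := restartPhase_eq_some hlen hr
  rcases Nat.eq_zero_or_pos k with rfl | hk0
  · rw [output_zero, add_zero]
    exact output_eq_some _ (by simp [h4])
  · have := action_restartPolicy (i₀ := i₀) (pol := pol) hlen x h (r + k - 1)
    rw [h5 (r + k - 1) (by omega) (by omega), Nat.sub_add_cancel (by omega)] at this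
    simp only [Nat.add_sub_cancel_left] at this
    simp only [output, this, show r + k ≠ 0 by omega, show k ≠ 0 by omega]

lemma dependsUpTo_restartPhase (π : TransmissionPolicy S) (t : ℕ) :
    DependsUpTo t (fun x h => restartPhase i₀ len (output π x h) t) := fun _ _ _ _ A =>
  restartPhase_congr fun s _ hs => dependsUpTo_output π s (A.mono hs)

end Restart

/-! ### Waiting time for a given state -/

namespace RemoteEstimation

variable {S : Type*} [Fintype S] [DecidableEq S] (M : RemoteEstimation S)

/-- A bound on the expected time until the state `i₀` is received under permanent
transmission. -/
lemma exists_hittingTime (hps : 0 < M.ps) (i₀ : S) : ∃ τ : S → ℝ≥0, ∀ i,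
    1 + ∑ j, M.trans i j * ((if j = i₀ then M.channel false else 1) * τ j) ≤ τ i := by
  have hQ := M.Q_stochastic.1
  have hQ1 := fun i => Matrix.sum_row_of_mem_rowStochastic M.Q_stochastic i
  have hps1 := M.ps_mem.2
  set k : S → ℝ := fun j => if j = i₀ then 1 - M.ps else 1 with hk
  have hk0 : ∀ j, 0 ≤ k j := fun j => by simp only [hk]; split_ifs <;> linarith
  have hk1 : ∀ j, k j ≤ 1 := fun j => by simp only [hk]; split_ifs <;> linarith
  have hne : Nonempty S := ⟨i₀⟩
  -- The expected waiting times solve a linear system with one equation per state; injectivity of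
  -- the operator yields a solution.
  let A : (S → ℝ) →ₗ[ℝ] (S → ℝ) :=
    LinearMap.pi fun i => LinearMap.proj i - ∑ j, (M.Q i j * k j) • LinearMap.proj j
  have hA : ∀ v i, A v i = v i - ∑ j, M.Q i j * k j * v j := fun v i => by simp [A]
  have hinj : Function.Injective A := by
    rw [← LinearMap.ker_eq_bot, LinearMap.ker_eq_bot']
    intro v hv
    obtain ⟨m, hm⟩ := Finite.exists_max fun i => |v i|
    have hv' : ∀ i, v i = ∑ j, M.Q i j * k j * v j := fun i => by
      have := congrFun hv i
      rw [hA] at this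
      simpa [sub_eq_zero] using this
    by_contra hv0
    have hpos : 0 < |v m| := by
      by_contra h0
      refine hv0 (funext fun i => ?_)
      have := (hm i).trans (not_lt.1 h0)
      simpa using this
    -- Maximum principle: equality at a state of maximal modulus passes to all its successors and
    -- excludes `i₀` among them, where `1 - ps < 1` would make the inequality strict.
    have hstep : ∀ i, |v i| = |v m| → ∀ j, 0 < M.Q i j → |v j| = |v m| ∧ j ≠ i₀ := by
      intro i hi j hij
      have h1 : ∑ l, M.Q i l * |v m| ≤ ∑ l, M.Q i l * (k l * |v l|) := by
        rw [← Finset.sum_mul, hQ1, one_mul, ← hi, hv' i]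
        refine (Finset.abs_sum_le_sum_abs _ _).trans (Finset.sum_le_sum fun l _ => ?_)
        rw [abs_mul, abs_of_nonneg (mul_nonneg (hQ i l) (hk0 l)), mul_assoc]
      have h2 : ∀ l ∈ Finset.univ, M.Q i l * (k l * |v l|) ≤ M.Q i l * |v m| := fun l _ =>
        mul_le_mul_of_nonneg_left
          ((mul_le_of_le_one_left (abs_nonneg _) (hk1 l)).trans (hm l)) (hQ i l)
      have h3 := (Finset.sum_eq_sum_iff_of_le h2).1 (le_antisymm (Finset.sum_le_sum h2) h1) j
        (Finset.mem_univ j)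
      have h4 : k j * |v j| = |v m| := mul_left_cancel₀ hij.ne' h3
      have h5 : j ≠ i₀ := by
        rintro rfl
        simp only [hk, if_true] at h4
        have := hm j
        nlinarith [abs_nonneg (v j)]
      simp only [hk, if_neg h5, one_mul] at h4
      exact ⟨h4, h5⟩
    let : Quiver S := Matrix.toQuiver M.Q
    -- The path must have positive length: if `m = i₀`, the empty path gives no contradiction.
    obtain ⟨p, hp⟩ := M.Q_irreducible.2 m i₀
    have hpath : ∀ (j : S) (p : Quiver.Path m j), |v j| = |v m| ∧ (0 < p.length → j ≠ i₀) := by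
      intro j p
      induction p with
      | nil => exact ⟨rfl, fun h => absurd h (lt_irrefl _)⟩
      | cons p e ih =>
        obtain ⟨h1, h2⟩ := hstep _ ih.1 _ e.down
        exact ⟨h1, fun _ => h2⟩
    exact (hpath i₀ p).2 hp rfl
  obtain ⟨v, hv⟩ := (LinearMap.injective_iff_surjective.1 hinj) fun _ => 1
  have hv' : ∀ i, v i = 1 + ∑ j, M.Q i j * k j * v j := fun i => by
    have := congrFun hv i
    rw [hA] at this
    linarith
  have hv0 : ∀ i, 0 ≤ v i := by
    obtain ⟨m, hm⟩ := Finite.exists_min v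
    by_contra! hneg
    obtain ⟨i, hi⟩ := hneg
    have hm0 : v m < 0 := (hm i).trans_lt hi
    have h1 : ∑ j, M.Q m j * v m ≤ ∑ j, M.Q m j * k j * v j := by
      refine Finset.sum_le_sum fun j _ => ?_
      rw [mul_assoc]
      refine mul_le_mul_of_nonneg_left ?_ (hQ m j)
      nlinarith [hm j, hk0 j, hk1 j]
    rw [← Finset.sum_mul, hQ1, one_mul] at h1
    linarith [hv' m]
  refine ⟨fun i => (v i).toNNReal, fun i => le_of_eq ?_⟩
  have e1 : ∀ j, M.trans i j * ((if j = i₀ then M.channel false else 1) *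
      ((v j).toNNReal : ℝ≥0∞)) = ENNReal.ofReal (M.Q i j * k j * v j) := by
    intro j
    rw [ENNReal.ofReal_mul (mul_nonneg (hQ i j) (hk0 j)), ENNReal.ofReal_mul (hQ i j), mul_assoc]
    congr 2
    by_cases hj : j = i₀
    · simp only [hk, if_pos hj, channel, Bool.false_eq_true, if_false]
    · simp only [hk, if_neg hj, ENNReal.ofReal_one]
  simp_rw [e1]
  rw [← ENNReal.ofReal_sum_of_nonneg fun j _ =>
    mul_nonneg (mul_nonneg (hQ i j) (hk0 j)) (hv0 j), ← ENNReal.ofReal_one,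
    ← ENNReal.ofReal_add zero_le_one (Finset.sum_nonneg fun j _ =>
      mul_nonneg (mul_nonneg (hQ i j) (hk0 j)) (hv0 j)), ← hv' i]
  rfl

end RemoteEstimation

/-! ### Cost of a restarting policy -/

namespace RemoteEstimation

variable {S : Type*} [Fintype S] [DecidableEq S] (M : RemoteEstimation S)

/-- Conditional expectation at time `k` of the costs `c` at the next `m` steps, plus a terminal
cost `W`. -/
noncomputable def runValue (c : ℕ → (ℕ → S) → (ℕ → Bool) → ℝ≥0∞)
    (W : (ℕ → S) → (ℕ → Bool) → ℝ≥0∞) : ℕ → ℕ → (ℕ → S) → (ℕ → Bool) → ℝ≥0∞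
  | 0, _ => W
  | m + 1, k => M.condNext k fun x h => c (k + 1) x h + runValue c W m (k + 1) x h

variable {M}

lemma dependsUpTo_runValue {c : ℕ → (ℕ → S) → (ℕ → Bool) → ℝ≥0∞}
    {W : (ℕ → S) → (ℕ → Bool) → ℝ≥0∞} (hc : ∀ t, DependsUpTo t (c t)) {m k : ℕ}
    (hW : DependsUpTo (k + m) W) : DependsUpTo k (M.runValue c W m k) := by
  induction m generalizing k with
  | zero => exact hW
  | succ m ih =>
    exact dependsUpTo_condNext ((hc (k + 1)).comp₂ (· + ·)
      (ih (by rwa [show k + 1 + m = k + (m + 1) by ring])))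

lemma lintegral_runValue {Ω : Type*} [MeasurableSpace Ω] {P : Measure Ω} {X : ℕ → Ω → S}
    {H : ℕ → Ω → Bool} (hXH : M.IsSourceAndChannel P X H)
    {c : ℕ → (ℕ → S) → (ℕ → Bool) → ℝ≥0∞}
    {W : (ℕ → S) → (ℕ → Bool) → ℝ≥0∞} (hc : ∀ t, DependsUpTo t (c t)) {m k : ℕ}
    (hW : DependsUpTo (k + m) W) :
    ∫⁻ ω, M.runValue c W m k (fun s => X s ω) (fun s => H s ω) ∂P =
      ∑ i ∈ Finset.range m, ∫⁻ ω, c (k + i + 1) (fun s => X s ω) (fun s => H s ω) ∂P +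
        ∫⁻ ω, W (fun s => X s ω) (fun s => H s ω) ∂P := by
  induction m generalizing k with
  | zero => simp [runValue]
  | succ m ih =>
    have hW' : DependsUpTo (k + 1 + m) W := by rwa [show k + 1 + m = k + (m + 1) by ring]
    simp only [runValue]
    rw [lintegral_condNext hXH ((hc (k + 1)).comp₂ (· + ·) (dependsUpTo_runValue hc hW')),
      lintegral_add_left (measurable_of_depends hXH (hc (k + 1))), ih hW',
      Finset.sum_range_succ', add_comm (∑ i ∈ Finset.range m, _), add_assoc]
    simp only [add_zero, add_assoc, add_comm, add_left_comm]

lemma update_shift {α : Type*} (f : ℕ → α) (r k : ℕ) (a : α) :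
    (fun s => Function.update f (r + k + 1) a (r + s)) =
      Function.update (fun s => f (r + s)) (k + 1) a := by
  funext s
  rcases eq_or_ne s (k + 1) with rfl | hne
  · rw [← add_assoc, Function.update_self, Function.update_self]
  · rw [Function.update_of_ne (by omega), Function.update_of_ne hne]

lemma condNext_shift (F : (ℕ → S) → (ℕ → Bool) → ℝ≥0∞) (r k : ℕ) (x : ℕ → S) (h : ℕ → Bool) :
    M.condNext (r + k) (fun x h => F (fun s => x (r + s)) (fun s => h (r + s))) x h =
      M.condNext k F (fun s => x (r + s)) (fun s => h (r + s)) := by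
  simp only [condNext]
  refine Finset.sum_congr rfl fun j _ => Finset.sum_congr rfl fun b _ => ?_
  rw [update_shift, update_shift]

section RestartBound

variable {i₀ : S} {len : ℕ → ℕ} {pol : ℕ → TransmissionPolicy S}
  {c V : TransmissionPolicy S → ℕ → (ℕ → S) → (ℕ → Bool) → ℝ≥0∞}
  {W : ℕ → (ℕ → S) → (ℕ → Bool) → ℝ≥0∞} {κ : ℝ≥0∞} {τ : S → ℝ≥0∞} {A B : ℕ → ℝ≥0∞}

variable (M i₀ len pol c V W κ τ B) in
/-- Bound on the expected cost to go of a restarting policy. -/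
noncomputable def restartPotential (t : ℕ) (x : ℕ → S) (h : ℕ → Bool) : ℝ≥0∞ :=
  match restartPhase i₀ len (output (restartPolicy i₀ len pol) x h) t with
  | none => κ * τ (x t) + V (restartPolicy i₀ len pol) t x h + B t
  | some r => M.runValue (c (pol r)) (W r) (len r - (t - r)) (t - r)
      (fun s => x (r + s)) (fun s => h (r + s)) + B (r + len r)

lemma dependsUpTo_restartPotential (hlen : ∀ r, 1 ≤ len r) (hc : ∀ π t, DependsUpTo t (c π t))
    (hV : ∀ π t, DependsUpTo t (V π t)) (hW : ∀ r, DependsUpTo (len r) (W r)) (t : ℕ) :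
    DependsUpTo t (M.restartPotential i₀ len pol c V W κ τ B t) := by
  intro x x' h h' a
  have h1 : restartPhase i₀ len (output (restartPolicy i₀ len pol) x h) t =
      restartPhase i₀ len (output (restartPolicy i₀ len pol) x' h') t :=
    dependsUpTo_restartPhase _ t a
  simp only [restartPotential, ← h1]
  cases hr : restartPhase i₀ len (output (restartPolicy i₀ len pol) x h) t with
  | none => simp only [hV _ t a, a.1 t le_rfl]
  | some r =>
    obtain ⟨h2, h3, h4, -, -⟩ := restartPhase_eq_some hlen hr
    simp only
    congr 1
    refine dependsUpTo_runValue (hc _) ?_ (AgreeUpTo.shift (r := r) ?_)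
    · rw [show t - r + (len r - (t - r)) = len r by omega]
      exact hW r
    · rwa [show r + (t - r) = t by omega]

/-- While waiting, `V` drifts up by at most `κ` net of costs and `κ * τ` drops by at least `κ` on
average. When `i₀` arrives, the deterministic budget `B` funds the run, and `hB` leaves enough for
the time after it. During a run the conditional value balances the costs exactly, and at its end `W`
covers the waiting potential. -/
lemma restartPotential_drift (hlen : ∀ r, 1 ≤ len r) {T : ℕ}
    (hcs : ∀ x h t r, restartPhase i₀ len (output (restartPolicy i₀ len pol) x h) t = some r →
      c (restartPolicy i₀ len pol) (t + 1) x h =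
        c (pol r) (t + 1 - r) (fun s => x (r + s)) (fun s => h (r + s)))
    (hVs : ∀ x h t r, restartPhase i₀ len (output (restartPolicy i₀ len pol) x h) t = some r →
      V (restartPolicy i₀ len pol) (t + 1) x h =
        V (pol r) (t + 1 - r) (fun s => x (r + s)) (fun s => h (r + s)))
    (hdrift : ∀ x h t, restartPhase i₀ len (output (restartPolicy i₀ len pol) x h) t = none →
      M.condNext t (fun x h => c (restartPolicy i₀ len pol) (t + 1) x h +
        V (restartPolicy i₀ len pol) (t + 1) x h) x h ≤ V (restartPolicy i₀ len pol) t x h + κ)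
    (hτ : ∀ i, 1 + ∑ j, M.trans i j * ((if j = i₀ then M.channel false else 1) * τ j) ≤ τ i)
    (hWV : ∀ r x h, κ * τ (x (len r)) + V (pol r) (len r) x h ≤ W r x h)
    (hA : ∀ r x h, x 0 = i₀ → M.runValue (c (pol r)) (W r) (len r) 0 x h ≤ A r)
    (hBanti : Antitone B) (hB : ∀ r, 1 ≤ r → r ≤ T → A r + B (r + len r) ≤ B r)
    {t : ℕ} (ht : t < T) (x : ℕ → S) (h : ℕ → Bool) :
    M.condNext t (fun x h => c (restartPolicy i₀ len pol) (t + 1) x h +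
        M.restartPotential i₀ len pol c V W κ τ B (t + 1) x h) x h ≤
      M.restartPotential i₀ len pol c V W κ τ B t x h := by
  set π := restartPolicy i₀ len pol with hπ
  have hph : ∀ j b, restartPhase i₀ len (output π (Function.update x (t + 1) j)
      (Function.update h (t + 1) b)) t = restartPhase i₀ len (output π x h) t :=
    (dependsUpTo_restartPhase π t).update (Nat.lt_succ_self t) x h
  cases hr : restartPhase i₀ len (output π x h) t with
  | none =>
    -- The waiting potential after the step, set to zero if `i₀` is received.
    set G : (ℕ → S) → (ℕ → Bool) → ℝ≥0∞ := fun x h =>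
      κ * (if x (t + 1) = i₀ ∧ h (t + 1) = true then 0 else τ (x (t + 1))) with hG
    have hGc : M.condNext t G x h =
        κ * ∑ j, M.trans (x t) j * ((if j = i₀ then M.channel false else 1) * τ j) := by
      simp only [condNext, hG, Function.update_self, Finset.mul_sum]
      refine Finset.sum_congr rfl fun j _ => ?_
      rw [Fintype.sum_bool]
      by_cases hj : j = i₀
      · simp only [hj, and_self, if_true, and_false, Bool.false_eq_true, if_false]
        ring
      · simp only [hj, false_and, if_false]
        have := M.sum_channel
        rw [Fintype.sum_bool] at this
        calc _ = M.trans (x t) j * (κ * τ j) * (M.channel true + M.channel false) := by ring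
          _ = _ := by rw [this]; ring
    have hpt : ∀ j b, c π (t + 1) (Function.update x (t + 1) j) (Function.update h (t + 1) b) +
        M.restartPotential i₀ len pol c V W κ τ B (t + 1) (Function.update x (t + 1) j)
          (Function.update h (t + 1) b) ≤
        (c π (t + 1) (Function.update x (t + 1) j) (Function.update h (t + 1) b) +
          V π (t + 1) (Function.update x (t + 1) j) (Function.update h (t + 1) b)) +
        (G (Function.update x (t + 1) j) (Function.update h (t + 1) b) + B t) := by
      intro j b
      set x' := Function.update x (t + 1) j
      set h' := Function.update h (t + 1) b
      have hn : restartPhase i₀ len (output π x' h') t = none := (hph j b).trans hr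
      have hact : action π x' h' (t + 1) = true := by
        rw [hπ, action_restartPolicy hlen, ← hπ, hn]
      rw [add_assoc]
      gcongr
      simp only [restartPotential, restartPhase, ← hπ, hn]
      by_cases hhit : x' (t + 1) = i₀ ∧ h' (t + 1) = true
      · have ho : output π x' h' (t + 1) = some i₀ := by simp [output, hact, hhit]
        simp only [if_pos ho, Nat.sub_self, Nat.sub_zero]
        calc _ ≤ A (t + 1) + B (t + 1 + len (t + 1)) := by
              gcongr
              exact hA _ _ _ hhit.1
          _ ≤ B (t + 1) := hB _ (by omega) ht
          _ ≤ B t := hBanti (Nat.le_succ t)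
          _ ≤ _ := by
              rw [← add_assoc]
              exact le_add_of_nonneg_left zero_le
      · have ho : output π x' h' (t + 1) ≠ some i₀ := by
          intro ho
          simp only [output, hact, Bool.true_and, Nat.add_eq_zero_iff, one_ne_zero, and_false,
            false_or, Option.ite_none_right_eq_some, Option.some.injEq] at ho
          exact hhit ⟨ho.2, ho.1⟩
        simp only [if_neg ho, hG, if_neg hhit]
        calc _ ≤ κ * τ (x' (t + 1)) + V π (t + 1) x' h' + B t := by
              gcongr
              exact hBanti (Nat.le_succ t)
          _ = _ := by ring
    refine (condNext_mono (G := fun x h => (c π (t + 1) x h + V π (t + 1) x h) +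
      (G x h + B t)) hpt).trans ?_
    rw [condNext_add t (fun x h => c π (t + 1) x h + V π (t + 1) x h),
      condNext_add t G (fun _ _ => B t), condNext_const, hGc]
    simp only [restartPotential, ← hπ, hr]
    calc _ ≤ (V π t x h + κ) + (κ * ∑ j, M.trans (x t) j *
          ((if j = i₀ then M.channel false else 1) * τ j) + B t) := by
          gcongr
          exact hdrift x h t hr
      _ = κ * (1 + ∑ j, M.trans (x t) j *
          ((if j = i₀ then M.channel false else 1) * τ j)) + V π t x h + B t := by ring
      _ ≤ _ := by gcongr; exact hτ _
  | some r =>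
    obtain ⟨h2, h3, h4, -, -⟩ := restartPhase_eq_some hlen hr
    obtain ⟨k, rfl⟩ := Nat.exists_eq_add_of_le h3
    obtain ⟨m, hm⟩ : ∃ m, len r = k + m + 1 := ⟨len r - k - 1, by omega⟩
    have hpt : ∀ j b, c π (r + k + 1) (Function.update x (r + k + 1) j)
          (Function.update h (r + k + 1) b) +
        M.restartPotential i₀ len pol c V W κ τ B (r + k + 1) (Function.update x (r + k + 1) j)
          (Function.update h (r + k + 1) b) ≤
        (c (pol r) (k + 1) (fun s => Function.update x (r + k + 1) j (r + s))
            (fun s => Function.update h (r + k + 1) b (r + s)) +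
          M.runValue (c (pol r)) (W r) m (k + 1)
            (fun s => Function.update x (r + k + 1) j (r + s))
            (fun s => Function.update h (r + k + 1) b (r + s))) + B (r + len r) := by
      intro j b
      set x' := Function.update x (r + k + 1) j
      set h' := Function.update h (r + k + 1) b
      have hn : restartPhase i₀ len (output π x' h') (r + k) = some r := (hph j b).trans hr
      have e1 := hcs x' h' (r + k) r hn
      have e2 := hVs x' h' (r + k) r hn
      rw [show r + k + 1 - r = k + 1 by omega] at e1 e2
      rw [e1, add_assoc (c (pol r) _ _ _)]
      refine add_le_add_right ?_ _
      simp only [restartPotential, restartPhase, ← hπ, hn]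
      -- For `m = 0` this is the last step of the run, and the terminal cost is exchanged for the
      -- waiting potential.
      rcases Nat.eq_zero_or_pos m with rfl | hm0
      · rw [if_neg (by omega)]
        simp only [runValue, e2]
        have := hWV r (fun s => x' (r + s)) (fun s => h' (r + s))
        rw [show len r = k + 1 by omega] at this ⊢
        exact add_le_add this le_rfl
      · rw [if_pos (by omega)]
        simp only
        rw [show r + k + 1 - r = k + 1 by omega, show len r - (k + 1) = m by omega]
    refine (condNext_mono (G := fun x h => (fun x h => c (pol r) (k + 1) x h +
      M.runValue (c (pol r)) (W r) m (k + 1) x h) (fun s => x (r + s)) (fun s => h (r + s)) +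
      B (r + len r)) hpt).trans ?_
    rw [condNext_add (r + k) (fun x h => (fun x h => c (pol r) (k + 1) x h +
      M.runValue (c (pol r)) (W r) m (k + 1) x h) (fun s => x (r + s)) (fun s => h (r + s)))
      (fun _ _ => B (r + len r)), condNext_const]
    refine (add_le_add_left (condNext_shift (fun x h => c (pol r) (k + 1) x h +
      M.runValue (c (pol r)) (W r) m (k + 1) x h) r k x h).le _).trans ?_
    simp only [restartPotential, ← hπ, hr]
    rw [show r + k - r = k by omega, show len r - k = m + 1 by omega]
    exact le_rfl

/-- Expected total cost of a restarting policy. -/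
lemma sum_lintegral_restartPolicy_le {Ω : Type*} [MeasurableSpace Ω] {P : Measure Ω}
    [IsProbabilityMeasure P] {X : ℕ → Ω → S} {H : ℕ → Ω → Bool}
    (hXH : M.IsSourceAndChannel P X H)
    (hlen : ∀ r, 1 ≤ len r) {T : ℕ} (hc : ∀ π t, DependsUpTo t (c π t))
    (hV : ∀ π t, DependsUpTo t (V π t)) (hW : ∀ r, DependsUpTo (len r) (W r))
    (hcs : ∀ x h t r, restartPhase i₀ len (output (restartPolicy i₀ len pol) x h) t = some r →
      c (restartPolicy i₀ len pol) (t + 1) x h =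
        c (pol r) (t + 1 - r) (fun s => x (r + s)) (fun s => h (r + s)))
    (hVs : ∀ x h t r, restartPhase i₀ len (output (restartPolicy i₀ len pol) x h) t = some r →
      V (restartPolicy i₀ len pol) (t + 1) x h =
        V (pol r) (t + 1 - r) (fun s => x (r + s)) (fun s => h (r + s)))
    (hdrift : ∀ x h t, restartPhase i₀ len (output (restartPolicy i₀ len pol) x h) t = none →
      M.condNext t (fun x h => c (restartPolicy i₀ len pol) (t + 1) x h +
        V (restartPolicy i₀ len pol) (t + 1) x h) x h ≤ V (restartPolicy i₀ len pol) t x h + κ)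
    (hτ : ∀ i, 1 + ∑ j, M.trans i j * ((if j = i₀ then M.channel false else 1) * τ j) ≤ τ i)
    (hWV : ∀ r x h, κ * τ (x (len r)) + V (pol r) (len r) x h ≤ W r x h)
    (hA : ∀ r x h, x 0 = i₀ → M.runValue (c (pol r)) (W r) (len r) 0 x h ≤ A r)
    (hBanti : Antitone B) (hB : ∀ r, 1 ≤ r → r ≤ T → A r + B (r + len r) ≤ B r)
    {w : ℝ≥0∞} (hw : ∀ x h, κ * τ (x 0) + V (restartPolicy i₀ len pol) 0 x h ≤ w) :
    ∑ t ∈ Finset.Icc 1 T,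
      ∫⁻ ω, c (restartPolicy i₀ len pol) t (fun s => X s ω) (fun s => H s ω) ∂P ≤ w + B 0 := by
  have h1 := sum_lintegral_le_of_drift hXH (b := 0) (T := T)
    (hc (restartPolicy i₀ len pol)) (dependsUpTo_restartPotential (M := M) (κ := κ) (τ := τ)
      (B := B) (i₀ := i₀) (pol := pol) hlen hc hV hW)
    (fun t ht x h => by
      rw [add_zero]
      exact restartPotential_drift hlen hcs hVs hdrift hτ hWV hA hBanti hB ht x h)
  rw [mul_zero, add_zero] at h1
  refine (le_add_of_nonneg_right zero_le).trans (h1.trans ?_)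
  have h2 : ∀ x h, M.restartPotential i₀ len pol c V W κ τ B 0 x h ≤ w + B 0 := fun x h => by
    simp only [restartPotential, restartPhase]
    gcongr
    exact hw x h
  refine (lintegral_mono fun ω => h2 _ _).trans ?_
  simp

end RestartBound

end RemoteEstimation

/-! ### Run lengths and averages -/

section Schedule

/-- Index of the run that starts at time `r`: runs are long, but much shorter than `r`. -/
def runIndex (T : ℕ → ℕ) (r : ℕ) : ℕ := Nat.findGreatest (fun n => T n ^ 2 ≤ r) r

/-- `Nat.findGreatest` also returns 0 when no index qualifies, hence the extra `T 0`. -/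
lemma length_runIndex_le (T : ℕ → ℕ) (r : ℕ) : T (runIndex T r) ≤ T 0 + Nat.sqrt r := by
  rcases eq_or_ne (runIndex T r) 0 with h0 | h0
  · rw [h0]; omega
  · have : T (runIndex T r) ^ 2 ≤ r := 
      Nat.findGreatest_of_ne_zero (P := fun n => T n ^ 2 ≤ r) (n := r) rfl h0
    have := Nat.le_sqrt'.2 this
    omega

lemma exists_le_runIndex (T : ℕ → ℕ) (N : ℕ) : ∃ r₀, ∀ r, r₀ ≤ r → N ≤ runIndex T r :=
  ⟨N + T N ^ 2, fun _ hr => Nat.le_findGreatest (by omega) (by omega)⟩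

lemma tendsto_natSqrt_atTop : Tendsto Nat.sqrt atTop atTop :=
  tendsto_atTop.2 fun b => (eventually_ge_atTop (b * b)).mono fun _ hn => Nat.le_sqrt.2 hn

/-- Averages of a sequence whose partial sums are controlled by the costs `A` of runs. -/
lemma limsup_average_le_of_runs {T : ℕ → ℕ} (hT : ∀ n, 1 ≤ T n) {A : ℕ → ℝ≥0∞}
    (hA : ∀ n, A n ≠ ∞) {s : ℕ → ℝ≥0∞} {w β : ℝ≥0∞} (hw : w ≠ ∞)
    (hs : ∀ n (B : ℕ → ℝ≥0∞), Antitone B → (∀ r, 1 ≤ r → r ≤ n →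
      A (runIndex T r) + B (r + T (runIndex T r)) ≤ B r) → s n ≤ w + B 0)
    (hβ : ∃ N, ∀ n, N ≤ n → A n ≤ T n * β) :
    limsup (fun n : ℕ => (n : ℝ≥0∞)⁻¹ * s n) atTop ≤ β := by
  rcases eq_or_ne β ∞ with rfl | hβtop
  · exact le_top
  obtain ⟨N, hN⟩ := hβ
  obtain ⟨r₀, hr₀⟩ := exists_le_runIndex T N
  set D : ℝ≥0∞ := ∑ n ∈ Finset.range r₀, A n with hD
  have hDtop : D ≠ ∞ := ENNReal.sum_ne_top.2 fun n _ => hA n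
  have hbound : ∀ n, s n ≤ (w + D * r₀ + β * T 0) + β * n + β * Nat.sqrt n := by
    intro n
    -- The budget allots `D`, which covers any run started before `r₀`, to each remaining time
    -- before `r₀`, and `β` to each remaining time up to `n + T 0 + √n`, by which every run started
    -- by time `n` has ended.
    refine (hs n (fun r => D * ((r₀ - r : ℕ) : ℝ≥0∞) +
      β * ((n + (T 0 + Nat.sqrt n) - r : ℕ) : ℝ≥0∞)) ?_ ?_).trans (le_of_eq ?_)
    · intro a b hab
      simp only
      gcongr
    · intro r hr1 hrn
      have h1 := length_runIndex_le T r
      have h2 : Nat.sqrt r ≤ Nat.sqrt n := Nat.sqrt_le_sqrt hrn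
      have h3 := hT (runIndex T r)
      set l := T (runIndex T r) with hl
      rcases Nat.lt_or_ge r r₀ with hlt | hge
      · have h4 : A (runIndex T r) ≤ D := Finset.single_le_sum (f := A) (fun _ _ => zero_le)
          (Finset.mem_range.2 ((Nat.findGreatest_le r).trans_lt hlt))
        have h5 : ((r₀ - r : ℕ) : ℝ≥0∞) = ((r₀ - r - 1 : ℕ) : ℝ≥0∞) + 1 := by
          exact_mod_cast (show r₀ - r = (r₀ - r - 1) + 1 by omega)
        rw [h5, mul_add, mul_one, add_comm (D * _) D, add_assoc]
        gcongr ?_ + (_ * ?_ + _ * ?_)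
        · exact_mod_cast (show r₀ - (r + l) ≤ r₀ - r - 1 by omega)
        · exact_mod_cast (show n + (T 0 + Nat.sqrt n) - (r + l) ≤ n + (T 0 + Nat.sqrt n) - r by
            omega)
      · have h5 : ((n + (T 0 + Nat.sqrt n) - r : ℕ) : ℝ≥0∞) =
            l + ((n + (T 0 + Nat.sqrt n) - (r + l) : ℕ) : ℝ≥0∞) := by
          exact_mod_cast (show n + (T 0 + Nat.sqrt n) - r =
            l + (n + (T 0 + Nat.sqrt n) - (r + l)) by omega)
        rw [h5, show r₀ - (r + l) = 0 by omega, show r₀ - r = 0 by omega]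
        simp only [Nat.cast_zero, mul_zero, zero_add, mul_add]
        gcongr
        rw [mul_comm]
        exact hN _ (hr₀ r hge)
    · simp only [Nat.sub_zero]
      push_cast
      ring
  set K : ℝ≥0∞ := w + D * r₀ + β * T 0 with hK
  have hKtop : K ≠ ∞ := by finiteness
  have hlim : Tendsto (fun n : ℕ => K * (n : ℝ≥0∞)⁻¹ + β + β * ((Nat.sqrt n : ℕ) : ℝ≥0∞)⁻¹) atTop
      (𝓝 (K * 0 + β + β * 0)) :=
    ((ENNReal.Tendsto.const_mul ENNReal.tendsto_inv_nat_nhds_zero (Or.inr hKtop)).add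
      tendsto_const_nhds).add (ENNReal.Tendsto.const_mul
        (ENNReal.tendsto_inv_nat_nhds_zero.comp tendsto_natSqrt_atTop) (Or.inr hβtop))
  rw [mul_zero, mul_zero, zero_add, add_zero] at hlim
  rw [← hlim.limsup_eq]
  refine limsup_le_limsup ?_
  filter_upwards [eventually_ge_atTop 1] with n hn
  have hn0 : (n : ℝ≥0∞) ≠ 0 := by exact_mod_cast (show n ≠ 0 by omega)
  have hs0 : ((Nat.sqrt n : ℕ) : ℝ≥0∞) ≠ 0 := by
    exact_mod_cast (Nat.sqrt_pos.2 hn).ne'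
  have hsq : (n : ℝ≥0∞)⁻¹ * (Nat.sqrt n : ℕ) ≤ ((Nat.sqrt n : ℕ) : ℝ≥0∞)⁻¹ := by
    rw [ENNReal.le_inv_iff_mul_le, mul_assoc]
    calc (n : ℝ≥0∞)⁻¹ * ((Nat.sqrt n : ℕ) * (Nat.sqrt n : ℕ)) ≤ (n : ℝ≥0∞)⁻¹ * n := by
          gcongr
          exact_mod_cast Nat.sqrt_le n
      _ ≤ 1 := ENNReal.inv_mul_le_one _
  calc (n : ℝ≥0∞)⁻¹ * s n ≤ (n : ℝ≥0∞)⁻¹ * (K + β * n + β * Nat.sqrt n) := by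
        gcongr; exact hbound n
    _ = K * (n : ℝ≥0∞)⁻¹ + β * ((n : ℝ≥0∞)⁻¹ * n) + β * ((n : ℝ≥0∞)⁻¹ * Nat.sqrt n) := by ring
    _ ≤ K * (n : ℝ≥0∞)⁻¹ + β + β * ((Nat.sqrt n : ℕ) : ℝ≥0∞)⁻¹ := by
        gcongr
        exact mul_le_of_le_one_right' (ENNReal.inv_mul_le_one _)

end Schedule

/-! ### Concatenation of runs -/

namespace RemoteEstimation

section Attempt

variable {S : Type*}

/-- Indicator of a transmission attempt. -/
noncomputable def attempt (π : TransmissionPolicy S) (t : ℕ) (x : ℕ → S) (h : ℕ → Bool) : ℝ≥0∞ :=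
  if action π x h t = true then 1 else 0

lemma attempt_le_one (π : TransmissionPolicy S) (t : ℕ) (x : ℕ → S) (h : ℕ → Bool) :
    attempt π t x h ≤ 1 := by
  simp only [attempt]; split_ifs <;> simp

lemma dependsUpTo_attempt (π : TransmissionPolicy S) (t : ℕ) : DependsUpTo t (attempt π t) := by
  intro x x' h h' a
  have e : action π x h t = action π x' h' t := dependsUpTo_action π t a
  simp only [attempt, e]

end Attempt

variable {S : Type*} [Fintype S] [DecidableEq S] {M : RemoteEstimation S}

variable (M) in
/-- The cost at time `t` as an extended real path functional. -/
noncomputable def stageCost (π : TransmissionPolicy S) (t : ℕ) (x : ℕ → S) (h : ℕ → Bool) :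
    ℝ≥0∞ := M.cost π x h t

lemma dependsUpTo_stageCost (π : TransmissionPolicy S) (t : ℕ) :
    DependsUpTo t (M.stageCost π t) := M.dependsUpTo_cost π t

section Averages

variable {Ω : Type*} [MeasurableSpace Ω] {P : Measure Ω} {X : ℕ → Ω → S} {H : ℕ → Ω → Bool}

lemma averageCost_eq (hXH : M.IsSourceAndChannel P X H) (π : TransmissionPolicy S) :
    M.averageCost P X H π = limsup (fun n : ℕ => (n : ℝ≥0∞)⁻¹ * ∑ t ∈ Finset.range n,
      ∫⁻ ω, M.stageCost π t (fun s => X s ω) (fun s => H s ω) ∂P) atTop := by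
  refine congrArg (fun f => limsup f atTop) (funext fun n => ?_)
  rw [← lintegral_finsetSum _ fun t _ => measurable_of_depends hXH (dependsUpTo_stageCost π t),
    ← lintegral_const_mul _ (Finset.measurable_fun_sum _ fun t _ =>
      measurable_of_depends hXH (dependsUpTo_stageCost π t))]
  rfl

lemma frequency_eq (hXH : M.IsSourceAndChannel P X H) (π : TransmissionPolicy S) :
    frequency P X H π = limsup (fun n : ℕ => (n : ℝ≥0∞)⁻¹ * ∑ t ∈ Finset.Icc 1 n,
      ∫⁻ ω, attempt π t (fun s => X s ω) (fun s => H s ω) ∂P) atTop := by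
  refine congrArg (fun f => limsup f atTop) (funext fun n => ?_)
  rw [← lintegral_finsetSum _ fun t _ => measurable_of_depends hXH (dependsUpTo_attempt π t),
    ← lintegral_const_mul _ (Finset.measurable_fun_sum _ fun t _ =>
      measurable_of_depends hXH (dependsUpTo_attempt π t))]
  rfl

lemma sum_range_le_zero_add_Icc (e : ℕ → ℝ≥0∞) (n : ℕ) :
    ∑ t ∈ Finset.range n, e t ≤ e 0 + ∑ t ∈ Finset.Icc 1 n, e t := by
  have h : ∑ t ∈ Finset.Icc 1 n, e t = ∑ t ∈ Finset.range n, e (t + 1) := by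
    rw [Finset.range_eq_Ico, Finset.sum_Ico_add' e 0 n 1]
    rfl
  rw [h, add_comm, ← Finset.sum_range_succ']
  exact Finset.sum_le_sum_of_subset (Finset.range_mono (Nat.le_succ n))

lemma stageCost_zero_add_errorPotential_le (π : TransmissionPolicy S) (x : ℕ → S)
    (h : ℕ → Bool) : M.stageCost π 0 x h + M.errorPotential π x h 0 ≤ M.costBound 0 :=
  cost_add_errorPotential_le le_rfl

variable [IsProbabilityMeasure P]

/-- Runs from a common initial state can be concatenated into one policy, whose average cost and
transmission frequency are at most those of the late runs. -/
theorem exists_policy_of_runs [Nonempty S] (hXH : M.IsSourceAndChannel P X H)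
    (hρ : M.GrowthCondition) (hps : 0 < M.ps) :
    ∃ C : ℝ≥0, ∀ (i₀ : S) (T : ℕ → ℕ) (p : ℕ → TransmissionPolicy S) (A A' : ℕ → ℝ≥0∞),
      (∀ n, 1 ≤ T n) → (∀ n, A n ≠ ∞) → (∀ n, A' n ≠ ∞) →
      (∀ n x h, x 0 = i₀ → M.runValue (M.stageCost (p n))
        (fun x h => C * (1 + M.stageCost (p n) (T n) x h)) (T n) 0 x h ≤ A n) →
      (∀ n x h, x 0 = i₀ → M.runValue (attempt (p n)) (fun _ _ => C) (T n) 0 x h ≤ A' n) →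
      ∃ π : TransmissionPolicy S,
        (∀ β, (∃ N, ∀ n, N ≤ n → A n ≤ T n * β) → M.averageCost P X H π ≤ β) ∧
        (∀ β, (∃ N, ∀ n, N ≤ n → A' n ≤ T n * β) → frequency P X H π ≤ β) := by
  obtain ⟨CV, hCV⟩ := hρ.exists_errorPotential_le
  choose τ hτ using M.exists_hittingTime hps
  set Cτ : ℝ≥0 := ∑ i, ∑ j, τ i j with hCτ
  have hτle : ∀ i j, τ i j ≤ Cτ := fun i j =>
    (Finset.single_le_sum (f := fun j => τ i j) (fun _ _ => zero_le) (Finset.mem_univ j)).trans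
      (Finset.single_le_sum (f := fun i => ∑ j, τ i j) (fun _ _ => zero_le) (Finset.mem_univ i))
  obtain ⟨κ, hκ⟩ : ∃ κ : ℝ≥0, (κ : ℝ≥0∞) = M.costBound 1 :=
    ⟨_, ENNReal.coe_toNNReal (hρ.costBound_ne_top 1)⟩
  refine ⟨CV + κ * Cτ + Cτ, fun i₀ T p A A' hT hA hA' hrun hrun' => ?_⟩
  set len : ℕ → ℕ := fun r => T (runIndex T r) with hlen_def
  set pol : ℕ → TransmissionPolicy S := fun r => p (runIndex T r) with hpol
  have hlen : ∀ r, 1 ≤ len r := fun r => hT _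
  set π := restartPolicy i₀ len pol with hπ
  have hact : ∀ x h t, restartPhase i₀ len (output π x h) t = none → ∀ j b,
      action π (Function.update x (t + 1) j) (Function.update h (t + 1) b) (t + 1) = true := by
    intro x h t ht j b
    rw [hπ, action_restartPolicy hlen, ← hπ,
      (dependsUpTo_restartPhase π t).update (Nat.lt_succ_self t) x h j b, ht]
  have hout : ∀ x h t r, restartPhase i₀ len (output π x h) t = some r → r ≤ t ∧
      ∀ k ≤ t + 1 - r, output π x h (r + k) =
        output (pol r) (fun s => x (r + s)) (fun s => h (r + s)) k := fun x h t r hr =>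
    ⟨(restartPhase_eq_some hlen hr).2.1, output_restartPolicy hlen hr⟩
  refine ⟨π, fun β hβ => ?_, fun β hβ => ?_⟩
  · rw [averageCost_eq hXH]
    have hw : (κ * Cτ + M.costBound 0 + M.costBound 0 : ℝ≥0∞) ≠ ∞ := by
      have := hρ.costBound_ne_top 0
      finiteness
    refine limsup_average_le_of_runs hT hA hw (fun n B hBanti hB => ?_) hβ
    refine (sum_range_le_zero_add_Icc _ n).trans ?_
    have h0 : ∫⁻ ω, M.stageCost π 0 (fun s => X s ω) (fun s => H s ω) ∂P ≤ M.costBound 0 := by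
      refine (lintegral_mono fun ω => (le_add_of_nonneg_right zero_le).trans
        (stageCost_zero_add_errorPotential_le π _ _)).trans ?_
      simp
    have h1 := sum_lintegral_restartPolicy_le (M := M) (P := P) (X := X) (H := H) (i₀ := i₀)
      (len := len) (pol := pol) (c := M.stageCost) (V := fun π t x h => M.errorPotential π x h t)
      (W := fun r x h => ((CV + κ * Cτ + Cτ : ℝ≥0) : ℝ≥0∞) *
        (1 + M.stageCost (pol r) (len r) x h))
      (κ := κ) (τ := fun i => τ i₀ i) (A := fun r => A (runIndex T r)) (B := B)
      (w := κ * Cτ + M.costBound 0) (T := n) hXH hlen dependsUpTo_stageCost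
      M.dependsUpTo_errorPotential
      (fun r => (dependsUpTo_const _ (1 : ℝ≥0∞)).comp₂
        (fun a b => ((CV + κ * Cτ + Cτ : ℝ≥0) : ℝ≥0∞) * (a + b))
        (dependsUpTo_stageCost (pol r) (len r)))
      (fun x h t r hr => by
        obtain ⟨h1, h2⟩ := hout x h t r hr
        have := M.cost_shift h2 le_rfl
        rw [show r + (t + 1 - r) = t + 1 by omega] at this
        simp only [stageCost, ← hπ, this])
      (fun x h t r hr => by
        obtain ⟨h1, h2⟩ := hout x h t r hr
        have := errorPotential_shift (M := M) h2 le_rfl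
        rw [show r + (t + 1 - r) = t + 1 by omega] at this
        exact this)
      -- Waiting means permanent transmission, so the drift bound applies with threshold 0; this is
      -- where `κ = costBound 1` comes from.
      (fun x h t ht => by
        have := condNext_cost_le (M := M) (π := π) (x := x) (h := h) (t := t) (N := 0)
          fun _ b => hact x h t ht _ b
        rw [zero_add, ← hκ] at this
        exact this)
      (hτ i₀)
      (fun r x h => by
        have h1 := hCV (pol r) x h (len r)
        have h2 : (τ i₀ (x (len r)) : ℝ≥0∞) ≤ Cτ := ENNReal.coe_le_coe.2 (hτle _ _)
        simp only [stageCost]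
        generalize (M.cost (pol r) x h (len r) : ℝ≥0∞) = y at h1 ⊢
        calc _ ≤ (κ : ℝ≥0∞) * Cτ + CV * (1 + y) := by gcongr
          _ ≤ (κ : ℝ≥0∞) * Cτ + CV * (1 + y) + (κ * Cτ * y + Cτ * (1 + y)) :=
              le_add_of_nonneg_right zero_le
          _ = _ := by push_cast; ring)
      (fun r x h hx => hrun (runIndex T r) x h hx) hBanti hB
      (fun x h => by
        have h2 : (τ i₀ (x 0) : ℝ≥0∞) ≤ Cτ := ENNReal.coe_le_coe.2 (hτle _ _)
        gcongr
        exact (le_add_of_nonneg_left zero_le).trans (stageCost_zero_add_errorPotential_le π x h))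
    calc _ ≤ M.costBound 0 + (κ * Cτ + M.costBound 0 + B 0) := add_le_add h0 h1
      _ = _ := by ring
  · rw [frequency_eq hXH]
    refine limsup_average_le_of_runs hT hA' (w := Cτ) ENNReal.coe_ne_top
      (fun n B hBanti hB => ?_) hβ
    -- For attempts no potential is needed: a waiting step costs at most one attempt, so `V = 0` and
    -- `κ = 1`.
    refine sum_lintegral_restartPolicy_le (M := M) (P := P) (X := X) (H := H) (i₀ := i₀)
      (len := len) (pol := pol) (c := attempt) (V := fun _ _ _ _ => 0)
      (W := fun r x h => ((CV + κ * Cτ + Cτ : ℝ≥0) : ℝ≥0∞))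
      (κ := 1) (τ := fun i => τ i₀ i) (A := fun r => A' (runIndex T r)) (B := B)
      (T := n) hXH hlen dependsUpTo_attempt
      (fun _ _ => dependsUpTo_const _ _) (fun _ => dependsUpTo_const _ _)
      (fun x h t r hr => by
        have := action_restartPolicy (i₀ := i₀) (pol := pol) hlen x h t
        rw [hr] at this
        simp only [attempt, this])
      (fun _ _ _ _ _ => rfl)
      (fun x h t ht => by
        rw [zero_add]
        refine le_trans ?_ (M.condNext_const t 1 x h).le
        refine condNext_mono fun j b => ?_
        rw [add_zero]
        exact attempt_le_one _ _ _ _)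
      (hτ i₀)
      (fun r x h => by
        rw [one_mul, add_zero]
        have := hτle i₀ (x (len r))
        exact ENNReal.coe_le_coe.2 (this.trans (le_add_of_nonneg_left zero_le)))
      (fun r x h hx => hrun' (runIndex T r) x h hx) hBanti hB
      (fun x h => by
        rw [one_mul, add_zero]
        exact ENNReal.coe_le_coe.2 (hτle _ _))

end Averages

end RemoteEstimation

/-! ### Rarely transmitting policies of finite cost -/

section Policies

variable {S : Type*}

open Classical in
/-- Transmit when the source has been constant during the last `N` steps. -/
noncomputable def thresholdPolicy (S : Type*) (N : ℕ) : TransmissionPolicy S := fun t x _ _ =>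
  -- With a single state the source is always constant and the rule would transmit forever; there
  -- silence makes no error.
  decide (Nontrivial S ∧ N ≤ t ∧ ∀ s : Set.Iic t, t ≤ s + N → x s = x ⟨t, Set.mem_Iic.2 le_rfl⟩)

lemma action_thresholdPolicy {N : ℕ} {x : ℕ → S} {h : ℕ → Bool} {t : ℕ} :
    action (thresholdPolicy S N) x h t = true ↔
      Nontrivial S ∧ N ≤ t ∧ ∀ s ≤ t, t ≤ s + N → x s = x t := by
  rw [action, thresholdPolicy]
  simp

/-- Never transmit. -/
def silentPolicy (S : Type*) : TransmissionPolicy S := fun _ _ _ _ => false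

lemma action_silentPolicy (x : ℕ → S) (h : ℕ → Bool) (t : ℕ) :
    action (silentPolicy S) x h t = false := by
  rw [action, silentPolicy]

end Policies

namespace RemoteEstimation

variable {S : Type*} [Fintype S] [DecidableEq S] {M : RemoteEstimation S}

/-- Otherwise the rest of the row vanishes and `i` is absorbing, against irreducibility. -/
lemma trans_self_lt_one [Nontrivial S] (i : S) : M.trans i i < 1 := by
  rw [trans, ENNReal.ofReal_lt_one]
  by_contra! hge
  have h0 : ∀ j, j ≠ i → ¬ 0 < M.Q i j := by
    intro j hj hpos
    have h1 := Matrix.sum_row_of_mem_rowStochastic M.Q_stochastic i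
    have h2 : M.Q i i + M.Q i j ≤ ∑ l, M.Q i l := by
      rw [← Finset.sum_pair hj.symm]
      exact Finset.sum_le_sum_of_subset_of_nonneg (Finset.subset_univ _)
        fun l _ _ => M.Q_stochastic.1 i l
    linarith
  obtain ⟨j, hj⟩ := exists_ne i
  let : Quiver S := Matrix.toQuiver M.Q
  obtain ⟨p, -⟩ := M.Q_irreducible.2 i j
  have hpath : ∀ (j : S) (_ : Quiver.Path i j), j = i := by
    intro j p
    induction p with
    | nil => rfl
    | cons p e ih =>
      subst ih
      by_contra hne
      exact h0 _ hne e.down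
  exact hj (hpath j p)

lemma ne_estimate_of_errorAge_pos {π : TransmissionPolicy S} {x : ℕ → S} {h : ℕ → Bool} {t : ℕ}
    (ht : 0 < M.errorAge π x h t) : x t ≠ M.estimate π x h t := by
  cases t with
  | zero => simp [errorAge, ageOfConsecutiveError] at ht
  | succ t =>
    intro he
    simp [errorAge, ageOfConsecutiveError, he] at ht

section Averages

variable {Ω : Type*} [MeasurableSpace Ω] {P : Measure Ω}
  {X : ℕ → Ω → S} {H : ℕ → Ω → Bool}

/-- Long constancy of the source is unlikely. -/
lemma lintegral_const_le [IsProbabilityMeasure P] (hXH : M.IsSourceAndChannel P X H) (t N : ℕ) :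
    ∫⁻ ω, (if ∀ u ≤ N, X (t + u) ω = X t ω then 1 else 0 : ℝ≥0∞) ∂P ≤
      (⨆ i, M.trans i i) ^ N := by
  induction N with
  | zero =>
    refine (lintegral_mono (g := fun _ => 1) fun ω => ?_).trans (by simp)
    simp only
    split_ifs <;> simp
  | succ N ih =>
    set F : (ℕ → S) → (ℕ → Bool) → ℝ≥0∞ :=
      fun x _ => if ∀ u ≤ N + 1, x (t + u) = x t then 1 else 0 with hF
    have hdep : DependsUpTo (t + N + 1) F := by
      intro x x' h h' a
      have : (∀ u ≤ N + 1, x (t + u) = x t) ↔ ∀ u ≤ N + 1, x' (t + u) = x' t :=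
        forall₂_congr fun u hu => by rw [a.1 (t + u) (by omega), a.1 t (by omega)]
      simp only [hF, this]
    have h1 := lintegral_condNext hXH (n := t + N) hdep
    have h2 : ∀ x h, M.condNext (t + N) F x h ≤
        (⨆ i, M.trans i i) * if ∀ u ≤ N, x (t + u) = x t then 1 else 0 := by
      intro x h
      have hpt : ∀ j b, F (Function.update x (t + N + 1) j) (Function.update h (t + N + 1) b) ≤
          if j = x (t + N) then (if ∀ u ≤ N, x (t + u) = x t then 1 else 0) else 0 := by
        intro j b
        simp only [hF]
        split_ifs with h3 h4 h5 h5 <;> try simp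
        · refine h5 fun u hu => ?_
          have := h3 u (by omega)
          rwa [Function.update_of_ne (by omega), Function.update_of_ne (by omega)] at this
        · have h6 := h3 (N + 1) le_rfl
          have h7 := h3 N (by omega)
          rw [← h7, ← add_assoc, Function.update_self, Function.update_of_ne (by omega)] at h6
          exact h4 h6
      calc _ ≤ ∑ j, ∑ b, M.trans (x (t + N)) j * M.channel b *
            (if j = x (t + N) then (if ∀ u ≤ N, x (t + u) = x t then 1 else 0) else 0) :=
            Finset.sum_le_sum fun j _ => Finset.sum_le_sum fun b _ =>
              mul_le_mul_right (hpt j b) _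
        _ = M.trans (x (t + N)) (x (t + N)) * (∑ b, M.channel b) *
            (if ∀ u ≤ N, x (t + u) = x t then 1 else 0) := by
            rw [Finset.sum_eq_single (x (t + N)) (by intro j _ hj; simp [hj]) (by simp)]
            simp only [if_true]
            rw [Finset.mul_sum, Finset.sum_mul]
        _ ≤ _ := by
            rw [M.sum_channel, mul_one]
            gcongr
            exact le_iSup (fun i => M.trans i i) _
    calc _ = ∫⁻ ω, M.condNext (t + N) F (fun s => X s ω) (fun s => H s ω) ∂P := h1.symm
      _ ≤ ∫⁻ ω, (⨆ i, M.trans i i) *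
          (if ∀ u ≤ N, X (t + u) ω = X t ω then 1 else 0) ∂P := lintegral_mono fun ω => h2 _ _
      _ = (⨆ i, M.trans i i) *
          ∫⁻ ω, (if ∀ u ≤ N, X (t + u) ω = X t ω then 1 else 0) ∂P := by
          refine lintegral_const_mul _ (measurable_of_depends hXH (n := t + N)
            (G := fun x _ => if ∀ u ≤ N, x (t + u) = x t then 1 else 0) ?_)
          intro x x' h h' a
          have : (∀ u ≤ N, x (t + u) = x t) ↔ ∀ u ≤ N, x' (t + u) = x' t :=
            forall₂_congr fun u hu => by rw [a.1 (t + u) (by omega), a.1 t (by omega)]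
          simp only [this]
      _ ≤ _ := by
          rw [pow_succ']
          gcongr

lemma averageCost_le_of_drift [IsProbabilityMeasure P] (hXH : M.IsSourceAndChannel P X H) {π : TransmissionPolicy S}
    {b : ℝ≥0∞} (h0 : M.costBound 0 ≠ ∞)
    (hdrift : ∀ t x h, M.condNext t (fun x h => (M.cost π x h (t + 1) : ℝ≥0∞) +
      M.errorPotential π x h (t + 1)) x h ≤ M.errorPotential π x h t + b) :
    M.averageCost P X H π ≤ b := by
  rw [averageCost_eq hXH]
  have hbound : ∀ n : ℕ, ∑ t ∈ Finset.range n,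
      ∫⁻ ω, M.stageCost π t (fun s => X s ω) (fun s => H s ω) ∂P ≤ M.costBound 0 + n * b := by
    intro n
    have h1 := sum_lintegral_le_of_drift hXH (b := b) (T := n) (dependsUpTo_stageCost π)
      (M.dependsUpTo_errorPotential π) (fun t _ x h => hdrift t x h)
    have h2 : ∫⁻ ω, M.stageCost π 0 (fun s => X s ω) (fun s => H s ω) ∂P +
        ∫⁻ ω, M.errorPotential π (fun s => X s ω) (fun s => H s ω) 0 ∂P ≤ M.costBound 0 := by
      rw [← lintegral_add_left (measurable_of_depends hXH (dependsUpTo_stageCost π 0))]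
      refine (lintegral_mono fun ω => stageCost_zero_add_errorPotential_le π _ _).trans ?_
      simp
    calc _ ≤ _ := sum_range_le_zero_add_Icc _ n
      _ ≤ _ := add_le_add_right ((le_add_of_nonneg_right zero_le).trans h1) _
      _ ≤ _ := (add_assoc _ _ _).symm.le.trans (add_le_add h2 le_rfl)
  have hlim : Tendsto (fun n : ℕ => M.costBound 0 * (n : ℝ≥0∞)⁻¹ + b) atTop
      (𝓝 (M.costBound 0 * 0 + b)) :=
    (ENNReal.Tendsto.const_mul ENNReal.tendsto_inv_nat_nhds_zero (Or.inr h0)).add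
      tendsto_const_nhds
  rw [mul_zero, zero_add] at hlim
  rw [← hlim.limsup_eq]
  refine limsup_le_limsup (Eventually.of_forall fun n => ?_)
  calc (n : ℝ≥0∞)⁻¹ * _ ≤ (n : ℝ≥0∞)⁻¹ * (M.costBound 0 + n * b) := by
        gcongr; exact hbound n
    _ = M.costBound 0 * (n : ℝ≥0∞)⁻¹ + (n : ℝ≥0∞)⁻¹ * n * b := by ring
    _ ≤ M.costBound 0 * (n : ℝ≥0∞)⁻¹ + b := by
        gcongr
        exact mul_le_of_le_one_left' (ENNReal.inv_mul_le_one _)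

lemma frequency_le_of_forall (hXH : M.IsSourceAndChannel P X H) {π : TransmissionPolicy S}
    {b : ℝ≥0∞} (hb : ∀ t, ∫⁻ ω, attempt π t (fun s => X s ω) (fun s => H s ω) ∂P ≤ b) :
    frequency P X H π ≤ b := by
  rw [frequency_eq hXH]
  refine limsup_le_of_le (h := Eventually.of_forall fun n => ?_)
  calc (n : ℝ≥0∞)⁻¹ * _ ≤ (n : ℝ≥0∞)⁻¹ * (n * b) := by
        gcongr
        refine (Finset.sum_le_card_nsmul _ _ _ fun t _ => hb t).trans ?_
        simp
    _ ≤ b := by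
        rw [← mul_assoc]
        exact mul_le_of_le_one_left' (ENNReal.inv_mul_le_one _)

/-- There are policies of finite average cost that transmit arbitrarily rarely. -/
theorem exists_rare_policy [IsProbabilityMeasure P] [Nonempty S]
    (hXH : M.IsSourceAndChannel P X H) (hρ : M.GrowthCondition) {ε : ℝ≥0∞} (hε : 0 < ε) :
    ∃ π : TransmissionPolicy S, M.averageCost P X H π < ∞ ∧ frequency P X H π ≤ ε := by
  obtain ⟨N, hN1, hN⟩ : ∃ N, 1 ≤ N ∧ (Nontrivial S → (⨆ i, M.trans i i) ^ N ≤ ε) := by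
    by_cases hS : Nontrivial S
    · obtain ⟨i, hi⟩ := exists_eq_ciSup_of_finite (f := fun i => M.trans i i)
      have h1 : (⨆ i, M.trans i i) < 1 := hi ▸ trans_self_lt_one i
      have h2 := (ENNReal.tendsto_pow_atTop_nhds_zero_of_lt_one h1).eventually_lt_const hε
      obtain ⟨N, h3, h4⟩ := (h2.and (eventually_ge_atTop 1)).exists
      exact ⟨N, h4, fun _ => h3.le⟩
    · exact ⟨1, le_rfl, fun h => absurd h hS⟩
  refine ⟨thresholdPolicy S N, ?_, ?_⟩
  · refine (averageCost_le_of_drift hXH (hρ.costBound_ne_top 0)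
      fun t x h => condNext_cost_le (N := N) fun hage b => ?_).trans_lt
      (hρ.costBound_ne_top (N + 1)).lt_top
    rw [action_thresholdPolicy]
    -- An error of age at least `N` gives `N - 1` constant steps up to `t`; the step to `t + 1`,
    -- where the source stays, is the `N`-th and triggers the transmission.
    obtain ⟨h1, h2⟩ := source_const_of_lt_age (k := N - 1)
      (show N - 1 < ageOfConsecutiveError x (M.estimate (thresholdPolicy S N) x h) t from
        lt_of_lt_of_le (by omega) hage)
    refine ⟨⟨_, _, ne_estimate_of_errorAge_pos (lt_of_lt_of_le (by omega) hage)⟩, by omega,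
      fun s hs hsN => ?_⟩
    rw [Function.update_self]
    rcases Nat.lt_or_ge t s with h3 | h3
    · rw [show s = t + 1 by omega, Function.update_self]
    · rw [Function.update_of_ne (by omega), h2 s h3 (by omega)]
  · refine frequency_le_of_forall hXH fun t => ?_
    by_cases hS : Nontrivial S ∧ N ≤ t
    · refine le_trans (lintegral_mono fun ω => ?_)
        ((lintegral_const_le hXH (t - N) N).trans (hN hS.1))
      simp only [attempt]
      split_ifs with h1 h2
      · exact le_rfl
      · refine absurd (fun u hu => ?_) h2
        obtain ⟨-, -, h3⟩ := action_thresholdPolicy.1 h1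
        rw [h3 (t - N + u) (by omega) (by omega), h3 (t - N) (by omega) (by omega)]
      · exact zero_le
      · exact le_rfl
    · have : ∀ ω, attempt (thresholdPolicy S N) t (fun s => X s ω) (fun s => H s ω) = 0 := by
        intro ω
        rw [attempt, if_neg]
        rw [action_thresholdPolicy]
        exact fun h => hS ⟨h.1, h.2.1⟩
      simp [this]

/-- If transmissions never succeed, all policies have the same average cost. -/
lemma averageCost_eq_of_ps_eq_zero (hXH : M.IsSourceAndChannel P X H) (hps : M.ps = 0)
    (π π' : TransmissionPolicy S) : M.averageCost P X H π = M.averageCost P X H π' := by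
  have hH : ∀ᵐ ω ∂P, ∀ t, H (t + 1) ω = false := by
    rw [ae_all_iff]
    intro t
    have hdep : DependsUpTo (t + 1) (fun (_ : ℕ → S) (h : ℕ → Bool) =>
        if h (t + 1) = true then (1 : ℝ≥0∞) else 0) := fun _ _ _ _ a => by
      simp only [a.2 (t + 1) (by omega) le_rfl]
    have h1 := lintegral_condNext hXH hdep
    have h2 : ∀ x h, M.condNext t (fun (_ : ℕ → S) (h : ℕ → Bool) =>
        if h (t + 1) = true then (1 : ℝ≥0∞) else 0) x h = 0 := by
      intro x h
      simp [condNext, channel, hps]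
    simp only [h2, lintegral_zero] at h1
    have h3 := (lintegral_eq_zero_iff (measurable_of_depends hXH hdep)).1 h1.symm
    filter_upwards [h3] with ω hω
    by_contra hne
    rw [Bool.not_eq_false] at hne
    simp [hne] at hω
  rw [averageCost_eq hXH, averageCost_eq hXH]
  have key : ∀ t, ∫⁻ ω, M.stageCost π t (fun s => X s ω) (fun s => H s ω) ∂P =
      ∫⁻ ω, M.stageCost π' t (fun s => X s ω) (fun s => H s ω) ∂P := by
    intro t
    refine lintegral_congr_ae ?_
    filter_upwards [hH] with ω hω
    -- The shift lemma with `r = 0` compares two policies along the same paths.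
    have hout : ∀ k ≤ t, output π (fun s => X s ω) (fun s => H s ω) (0 + k) =
        output π' (fun s => X (0 + s) ω) (fun s => H (0 + s) ω) k := by
      intro k _
      simp only [zero_add]
      cases k with
      | zero => rw [output_zero, output_zero]
      | succ k => simp [output, hω k]
    have := M.cost_shift hout le_rfl
    simp only [zero_add] at this
    simp only [stageCost, this]
  simp only [key]

lemma runValue_attempt_le (π : TransmissionPolicy S) (C : ℝ≥0∞) (m k : ℕ) (x : ℕ → S)
    (h : ℕ → Bool) : M.runValue (attempt π) (fun _ _ => C) m k x h ≤ m + C := by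
  induction m generalizing k x h with
  | zero => simp [runValue]
  | succ m ih =>
    simp only [runValue]
    refine le_trans (condNext_mono fun j b => ?_)
      (M.condNext_const k (((m + 1 : ℕ) : ℝ≥0∞) + C) x h).le
    calc _ ≤ 1 + (m + C) := add_le_add (attempt_le_one _ _ _ _) (ih _ _ _)
      _ = _ := by push_cast; ring

end Averages

/-- A horizon at which averages are close to their upper limits and the last term is small. -/
lemma exists_horizon {e u : ℕ → ℝ≥0∞} (hu : ∀ t, u t ≤ 1) {C lam : ℝ≥0} {β : ℝ≥0∞}
    (hβ : limsup (fun n : ℕ => (n : ℝ≥0∞)⁻¹ * ∑ t ∈ Finset.range n, e t) atTop +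
      lam * limsup (fun n : ℕ => (n : ℝ≥0∞)⁻¹ * ∑ t ∈ Finset.Icc 1 n, u t) atTop < β) :
    ∃ T : ℕ, 1 ≤ T ∧ (∑ i ∈ Finset.range T, e (0 + i + 1) + C * (1 + e T)) +
      lam * (∑ i ∈ Finset.range T, u (0 + i + 1) + C) ≤ T * β := by
  set J := limsup (fun n : ℕ => (n : ℝ≥0∞)⁻¹ * ∑ t ∈ Finset.range n, e t) atTop with hJ
  set F := limsup (fun n : ℕ => (n : ℝ≥0∞)⁻¹ * ∑ t ∈ Finset.Icc 1 n, u t) atTop with hF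
  have hJtop : J ≠ ∞ := ne_top_of_lt (lt_of_le_of_lt (le_add_of_nonneg_right zero_le) hβ)
  have hFtop : F ≠ ∞ := by
    refine ne_top_of_le_ne_top ENNReal.one_ne_top
      (limsup_le_of_le (h := Eventually.of_forall fun n => ?_))
    refine le_trans ?_ (ENNReal.inv_mul_le_one (n : ℝ≥0∞))
    gcongr
    refine (Finset.sum_le_card_nsmul _ _ _ fun t _ => hu t).trans ?_
    simp
  obtain ⟨δ, hδ0, hδ⟩ := ENNReal.lt_iff_exists_add_pos_lt.1 hβ
  -- The slack `δ` is shared: `ε` for the cost average, `lam * ε` for the frequency, and `ε` for the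
  -- horizon-independent terms `K`.
  set ε : ℝ≥0 := min 1 (δ / (2 + lam)) with hε
  have hε0 : 0 < ε := lt_min one_pos (by positivity)
  have hεδ : (2 + lam) * ε ≤ δ := by
    calc (2 + lam) * ε ≤ (2 + lam) * (δ / (2 + lam)) := by gcongr; exact min_le_right _ _
      _ = δ := by field_simp
  have hεtop : (ε : ℝ≥0∞) ≠ 0 := by exact_mod_cast hε0.ne'
  have h1 : ∀ᶠ n : ℕ in atTop, (n : ℝ≥0∞)⁻¹ * ∑ t ∈ Finset.range n, e t < J + ε :=
    eventually_lt_of_limsup_lt (ENNReal.lt_add_right hJtop hεtop)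
  have h2 : ∀ᶠ n : ℕ in atTop, (n : ℝ≥0∞)⁻¹ * ∑ t ∈ Finset.Icc 1 n, u t < F + ε :=
    eventually_lt_of_limsup_lt (ENNReal.lt_add_right hFtop hεtop)
  have hunfold : ∀ {n : ℕ} {a b : ℝ≥0∞}, 1 ≤ n → (n : ℝ≥0∞)⁻¹ * a < b → a ≤ n * b := by
    intro n a b hn hab
    have hn0 : (n : ℝ≥0∞) ≠ 0 := by exact_mod_cast (show n ≠ 0 by omega)
    calc a = n * ((n : ℝ≥0∞)⁻¹ * a) := by
          rw [← mul_assoc, ENNReal.mul_inv_cancel hn0 (ENNReal.natCast_ne_top n), one_mul]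
      _ ≤ n * b := by gcongr
  set K : ℝ≥0∞ := (1 + C) * (2 * (J + ε)) + C + lam * C with hK
  have hKtop : K ≠ ∞ := by finiteness
  have h3 : ∀ᶠ n : ℕ in atTop, K ≤ n * ε := by
    have : Tendsto (fun n : ℕ => K * (n : ℝ≥0∞)⁻¹) atTop (𝓝 (K * 0)) :=
      ENNReal.Tendsto.const_mul ENNReal.tendsto_inv_nat_nhds_zero (Or.inr hKtop)
    rw [mul_zero] at this
    filter_upwards [this.eventually_lt_const (pos_iff_ne_zero.2 hεtop), eventually_ge_atTop 1]
      with n hn hn1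
    exact hunfold hn1 (by rwa [mul_comm])
  obtain ⟨n₀, hn₀⟩ := eventually_atTop.1 (h1.and (h2.and h3))
  set T₀ := n₀ + 1 with hT₀
  -- The last cost alone could be of order `T`. If all costs in `[T₀, 2T₀)` exceeded `2 * (J + ε)`,
  -- the average at `2T₀` would be at least `J + ε`.
  obtain ⟨T, hT1, hT2, hT3⟩ : ∃ T, T₀ ≤ T ∧ T < 2 * T₀ ∧ e T ≤ 2 * (J + ε) := by
    by_contra! hcon
    have h4 : (T₀ : ℝ≥0∞) * (2 * (J + ε)) ≤ ∑ t ∈ Finset.range (2 * T₀), e t := by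
      calc (T₀ : ℝ≥0∞) * (2 * (J + ε)) = ∑ t ∈ Finset.Ico T₀ (2 * T₀), 2 * (J + ε) := by
            rw [Finset.sum_const, Nat.card_Ico, nsmul_eq_mul]
            congr 2
            omega
        _ ≤ ∑ t ∈ Finset.Ico T₀ (2 * T₀), e t := Finset.sum_le_sum fun t ht => by
            rw [Finset.mem_Ico] at ht
            exact (hcon t ht.1 ht.2).le
        _ ≤ _ := Finset.sum_le_sum_of_subset fun t ht => by
            rw [Finset.mem_Ico] at ht
            exact Finset.mem_range.2 ht.2
    have h5 := (hn₀ (2 * T₀) (by omega)).1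
    have h6 : J + ε ≤ ((2 * T₀ : ℕ) : ℝ≥0∞)⁻¹ * ∑ t ∈ Finset.range (2 * T₀), e t := by
      have hn0 : ((2 * T₀ : ℕ) : ℝ≥0∞) ≠ 0 := by exact_mod_cast (show 2 * T₀ ≠ 0 by omega)
      calc J + ε = ((2 * T₀ : ℕ) : ℝ≥0∞)⁻¹ * ((2 * T₀ : ℕ) * (J + ε)) := by
            rw [← mul_assoc, ENNReal.inv_mul_cancel hn0 (ENNReal.natCast_ne_top _), one_mul]
        _ = ((2 * T₀ : ℕ) : ℝ≥0∞)⁻¹ * (T₀ * (2 * (J + ε))) := by push_cast; ring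
        _ ≤ _ := by gcongr
    exact absurd h5 (not_lt.2 h6)
  obtain ⟨h4, h5, h6⟩ := hn₀ T (by omega)
  have h7 := hunfold (by omega) h4
  have h8 := hunfold (by omega) h5
  have e1 : ∑ i ∈ Finset.range T, e (0 + i + 1) ≤ ∑ t ∈ Finset.range T, e t + e T := by
    rw [← Finset.sum_range_succ, Finset.sum_range_succ']
    simp
  have e2 : ∑ i ∈ Finset.range T, u (0 + i + 1) = ∑ t ∈ Finset.Icc 1 T, u t := by
    simp only [zero_add]
    rw [Finset.range_eq_Ico, Finset.sum_Ico_add' u 0 T 1]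
    rfl
  refine ⟨T, by omega, ?_⟩
  rw [e2]
  calc _ ≤ (T * (J + ε) + 2 * (J + ε) + C * (1 + 2 * (J + ε))) + lam * (T * (F + ε) + C) := by
        gcongr
        exact e1.trans (add_le_add h7 hT3)
    _ = T * (J + ε) + lam * (T * (F + ε)) + K := by rw [hK]; ring
    _ ≤ T * (J + ε) + lam * (T * (F + ε)) + T * ε := by gcongr
    _ = T * (J + lam * F + (2 + lam) * ε) := by ring
    _ ≤ T * (J + lam * F + δ) := by
        gcongr
        exact_mod_cast hεδ
    _ ≤ T * β := by gcongr

end RemoteEstimation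

/-! ### Existence of optimal policies -/

namespace RemoteEstimation

variable {S : Type*} [Fintype S] [DecidableEq S] {M : RemoteEstimation S}
  {Ω : Type*} [MeasurableSpace Ω] {P : Measure Ω} [IsProbabilityMeasure P]
  {X : ℕ → Ω → S} {H : ℕ → Ω → Bool}

/-- Finite-horizon values close to the Lagrangian cost of a policy, from some initial state. -/
lemma exists_run (hXH : M.IsSourceAndChannel P X H) (C lam : ℝ≥0) {π : TransmissionPolicy S}
    {β : ℝ≥0∞} (hβ : M.lagrangian P X H lam π < β) :
    ∃ (T : ℕ) (i : S) (a a' : ℝ≥0∞), 1 ≤ T ∧ a + lam * a' ≤ T * β ∧ a' ≤ T + C ∧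
      (∀ x h, x 0 = i → M.runValue (M.stageCost π)
        (fun x h => C * (1 + M.stageCost π T x h)) T 0 x h = a) ∧
      (∀ x h, x 0 = i → M.runValue (attempt π) (fun _ _ => C) T 0 x h = a') := by
  rw [lagrangian, averageCost_eq hXH, frequency_eq hXH] at hβ
  obtain ⟨T, hT1, hT⟩ := exists_horizon (fun t => (lintegral_mono fun ω =>
    attempt_le_one π t _ _).trans (by simp)) (C := C) hβ
  have hW : DependsUpTo T (fun x h => (C : ℝ≥0∞) * (1 + M.stageCost π T x h)) :=
    (dependsUpTo_const T (1 : ℝ≥0∞)).comp₂ (fun a b => (C : ℝ≥0∞) * (a + b))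
      (dependsUpTo_stageCost π T)
  have hR := dependsUpTo_runValue (M := M) (dependsUpTo_stageCost (M := M) π) (m := T) (k := 0)
    (by rwa [zero_add])
  have hR' := dependsUpTo_runValue (M := M) (dependsUpTo_attempt π) (m := T) (k := 0)
    (dependsUpTo_const (0 + T) (C : ℝ≥0∞))
  have hint : ∫⁻ ω, (M.runValue (M.stageCost π) (fun x h => C * (1 + M.stageCost π T x h)) T 0
        (fun s => X s ω) (fun s => H s ω) +
      lam * M.runValue (attempt π) (fun _ _ => C) T 0 (fun s => X s ω) (fun s => H s ω)) ∂P ≤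
      T * β := by
    rw [lintegral_add_left (measurable_of_depends hXH hR),
      lintegral_const_mul _ (measurable_of_depends hXH hR'),
      lintegral_runValue hXH (dependsUpTo_stageCost π) (by rwa [zero_add]),
      lintegral_runValue hXH (dependsUpTo_attempt π) (dependsUpTo_const _ _),
      lintegral_const_mul _ (measurable_of_depends hXH
        ((dependsUpTo_const T (1 : ℝ≥0∞)).comp₂ (· + ·) (dependsUpTo_stageCost π T))),
      lintegral_add_left measurable_const]
    simpa using hT
  -- Some outcome does no worse than the mean, and a value at time 0 depends only on the initial
  -- state.
  obtain ⟨ω, hω⟩ := exists_le_lintegral (μ := P) ((measurable_of_depends hXH hR).add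
    ((measurable_of_depends hXH hR').const_mul (lam : ℝ≥0∞))).aemeasurable
  have hagree : ∀ (x : ℕ → S) (h : ℕ → Bool), x 0 = X 0 ω →
      AgreeUpTo 0 x (fun s => X s ω) h (fun s => H s ω) := fun x h hx =>
    ⟨fun s hs => by obtain rfl := Nat.le_zero.1 hs; exact hx, fun s h1 hs => by omega⟩
  exact ⟨T, X 0 ω, _, _, hT1, hω.trans hint, runValue_attempt_le π C T 0 _ _,
    fun x h hx => hR (hagree x h hx), fun x h hx => hR' (hagree x h hx)⟩

/-- The infimum of the Lagrangian cost is attained. -/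
theorem exists_isLambdaOptimal (hXH : M.IsSourceAndChannel P X H) (hρ : M.GrowthCondition)
    (lam : ℝ≥0) : ∃ π : TransmissionPolicy S, M.IsLambdaOptimal P X H lam π := by
  obtain ⟨ω₀⟩ := P.nonempty_of_neZero
  have : Nonempty S := ⟨X 0 ω₀⟩
  rcases M.ps_mem.1.eq_or_lt with hps | hps
  · refine ⟨silentPolicy S, fun π => ?_⟩
    have h0 : frequency P X H (silentPolicy S) = 0 :=
      le_antisymm (frequency_le_of_forall hXH fun t => by
        simp [attempt, action_silentPolicy]) zero_le
    rw [lagrangian, lagrangian, h0, mul_zero, add_zero,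
      averageCost_eq_of_ps_eq_zero hXH hps.symm (silentPolicy S) π]
    exact le_add_of_nonneg_right zero_le
  obtain ⟨C, hC⟩ := exists_policy_of_runs hXH hρ hps
  set v : ℝ≥0∞ := ⨅ π, M.lagrangian P X H lam π with hv
  have hvtop : v ≠ ∞ := by
    obtain ⟨π, h1, h2⟩ := exists_rare_policy hXH hρ (ε := 1) one_pos
    refine ne_top_of_le_ne_top ?_ (iInf_le _ π)
    have h3 := ne_top_of_le_ne_top ENNReal.one_ne_top h2
    have h4 := h1.ne
    rw [lagrangian]
    finiteness
  have hne : ∀ n : ℕ, ((n : ℝ≥0∞) + 1)⁻¹ ≠ 0 := fun n =>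
    ENNReal.inv_ne_zero.2 (by finiteness)
  have hex : ∀ n : ℕ, ∃ π, M.lagrangian P X H lam π < v + ((n : ℝ≥0∞) + 1)⁻¹ := fun n =>
    iInf_lt_iff.1 (ENNReal.lt_add_right hvtop (hne n))
  choose p hp using hex
  choose T i a a' hT1 hle ha' hrun hrun' using fun n => exists_run hXH C lam (hp n)
  have hT0 : ∀ n, (T n : ℝ≥0∞) ≠ 0 := fun n => by
    have := hT1 n
    exact_mod_cast (show T n ≠ 0 by omega)
  have hTtop : ∀ n, (T n : ℝ≥0∞) ≠ ∞ := fun n => ENNReal.natCast_ne_top _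
  let : TopologicalSpace S := ⊥
  have : DiscreteTopology S := ⟨rfl⟩
  -- Compactness of `S × ℝ≥0∞ × ℝ≥0∞` with `S` discrete: the initial state is eventually constant
  -- along the subsequence, and both averages converge.
  obtain ⟨⟨i₀, j, f⟩, φ, hφ, hlim⟩ := CompactSpace.tendsto_subseq
    fun n => (i n, a n / T n, a' n / T n)
  have hlimi : Tendsto (fun n => i (φ n)) atTop (𝓝 i₀) :=
    (continuous_fst.tendsto _).comp hlim
  have hlimj : Tendsto (fun n => a (φ n) / T (φ n)) atTop (𝓝 j) :=
    ((continuous_fst.comp continuous_snd).tendsto _).comp hlim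
  have hlimf : Tendsto (fun n => a' (φ n) / T (φ n)) atTop (𝓝 f) :=
    ((continuous_snd.comp continuous_snd).tendsto _).comp hlim
  have hjf : j + lam * f ≤ v := by
    have h1 : Tendsto (fun n => a (φ n) / T (φ n) + lam * (a' (φ n) / T (φ n))) atTop
        (𝓝 (j + lam * f)) :=
      hlimj.add (ENNReal.Tendsto.const_mul hlimf (Or.inr ENNReal.coe_ne_top))
    have h2 : Tendsto (fun n : ℕ => v + (((φ n : ℕ) : ℝ≥0∞) + 1)⁻¹) atTop (𝓝 (v + 0)) := by
      refine tendsto_const_nhds.add ?_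
      have := (ENNReal.tendsto_inv_nat_nhds_zero.comp (tendsto_add_atTop_nat 1)).comp
        hφ.tendsto_atTop
      simpa [Function.comp_def] using this
    rw [add_zero] at h2
    refine le_of_tendsto_of_tendsto' h1 h2 fun n => ?_
    rw [← mul_div_assoc, ← ENNReal.add_div]
    refine ENNReal.div_le_of_le_mul ?_
    exact (hle (φ n)).trans_eq (mul_comm _ _)
  rw [nhds_discrete, tendsto_pure] at hlimi
  obtain ⟨N, hN⟩ := eventually_atTop.1 hlimi
  have hlimj' := hlimj.comp (tendsto_add_atTop_nat N)
  have hlimf' := hlimf.comp (tendsto_add_atTop_nat N)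
  obtain ⟨π, hπJ, hπF⟩ := hC i₀ (fun n => T (φ (n + N))) (fun n => p (φ (n + N)))
    (fun n => a (φ (n + N))) (fun n => a' (φ (n + N))) (fun n => hT1 _)
    (fun n => ne_top_of_le_ne_top (b := T (φ (n + N)) * (v + (((φ (n + N) : ℕ) : ℝ≥0∞) + 1)⁻¹))
      (ENNReal.mul_ne_top (hTtop _) (ENNReal.add_ne_top.2 ⟨hvtop, ENNReal.inv_ne_top.2 (by simp)⟩))
      ((le_add_of_nonneg_right zero_le).trans (hle (φ (n + N)))))
    -- A separate bound on attempts is needed, because for `lam = 0` the combined inequality does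
    -- not control them.
    (fun n => ne_top_of_le_ne_top (by finiteness) (ha' (φ (n + N))))
    (fun n x h hx => (hrun (φ (n + N)) x h (by rw [hx, hN _ (by omega)])).le)
    (fun n x h hx => (hrun' (φ (n + N)) x h (by rw [hx, hN _ (by omega)])).le)
  have hbound : ∀ {y : ℕ → ℝ≥0∞} {l β : ℝ≥0∞},
      Tendsto (fun n => y (φ (n + N)) / T (φ (n + N))) atTop (𝓝 l) → l < β →
      ∃ n₀, ∀ n, n₀ ≤ n → y (φ (n + N)) ≤ T (φ (n + N)) * β := by
    intro y l β hy hl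
    obtain ⟨n₀, hn₀⟩ := eventually_atTop.1 (hy.eventually_lt_const hl)
    refine ⟨n₀, fun n hn => ?_⟩
    rw [mul_comm, ← ENNReal.div_le_iff (hT0 _) (hTtop _)]
    exact (hn₀ n hn).le
  have hJ : M.averageCost P X H π ≤ j :=
    le_of_forall_gt_imp_ge_of_dense fun β hβ => hπJ β (hbound hlimj' hβ)
  have hF : frequency P X H π ≤ f :=
    le_of_forall_gt_imp_ge_of_dense fun β hβ => hπF β (hbound hlimf' hβ)
  refine ⟨π, fun π' => le_trans ?_ (iInf_le _ π')⟩
  rw [lagrangian]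
  exact le_trans (by gcongr) hjf

end RemoteEstimation

theorem theorem1 {S : Type*} [Fintype S] [DecidableEq S] (M : RemoteEstimation S)
    {Ω : Type*} [MeasurableSpace Ω] (P : Measure Ω) [IsProbabilityMeasure P]
    (X : ℕ → Ω → S) (H : ℕ → Ω → Bool) (hXH : M.IsSourceAndChannel P X H)
    (hρ : M.GrowthCondition) (Fmax : ℝ) (hF : Fmax ∈ Set.Ioc (0 : ℝ) 1) :
    (∀ lam : ℝ≥0,
      (∃ π : TransmissionPolicy S, M.IsLambdaOptimal P X H lam π) ∧
      ∀ π : TransmissionPolicy S, M.IsLambdaOptimal P X H lam π →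
        M.averageCost P X H π < ∞) ∧
    ∃ lam : ℝ≥0,
      (∃ π : TransmissionPolicy S, M.IsLambdaOptimal P X H lam π) ∧
      ∀ π : TransmissionPolicy S, M.IsLambdaOptimal P X H lam π →
        M.IsFeasible P X H Fmax π := by
  obtain ⟨ω₀⟩ := P.nonempty_of_neZero
  have : Nonempty S := ⟨X 0 ω₀⟩
  have hfin : ∀ lam : ℝ≥0, ∀ π : TransmissionPolicy S, M.IsLambdaOptimal P X H lam π →
      M.averageCost P X H π < ∞ := by
    intro lam π hπ
    obtain ⟨π', h1, h2⟩ := RemoteEstimation.exists_rare_policy hXH hρ (ε := 1) one_pos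
    refine ((le_add_of_nonneg_right zero_le).trans (hπ π')).trans_lt ?_
    exact ENNReal.add_lt_top.2 ⟨h1, ENNReal.mul_lt_top ENNReal.coe_lt_top
      (h2.trans_lt ENNReal.one_lt_top)⟩
  refine ⟨fun lam => ⟨RemoteEstimation.exists_isLambdaOptimal hXH hρ lam, hfin lam⟩, ?_⟩
  set F : ℝ≥0 := Fmax.toNNReal with hFdef
  have hF0 : 0 < F := Real.toNNReal_pos.2 hF.1
  obtain ⟨π', h1, h2⟩ := RemoteEstimation.exists_rare_policy hXH hρ (ε := ((F / 2 : ℝ≥0) : ℝ≥0∞))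
    (by exact_mod_cast half_pos hF0)
  obtain ⟨J, hJ⟩ : ∃ J : ℝ≥0, (J : ℝ≥0∞) = M.averageCost P X H π' :=
    ⟨_, ENNReal.coe_toNNReal h1.ne⟩
  -- Chosen so that `J ≤ lam * (F / 2)`: the comparison policy then has Lagrangian cost at most `lam
  -- * F`; the `+ 1` keeps `lam` positive for the final cancellation.
  set lam : ℝ≥0 := J / (F / 2) + 1 with hlam
  refine ⟨lam, RemoteEstimation.exists_isLambdaOptimal hXH hρ lam, fun π hπ =>
    ⟨hfin lam π hπ, ?_⟩⟩
  have h3 : (lam : ℝ≥0∞) * RemoteEstimation.frequency P X H π ≤ lam * F := by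
    calc _ ≤ M.lagrangian P X H lam π := le_add_of_nonneg_left zero_le
      _ ≤ M.lagrangian P X H lam π' := hπ π'
      _ ≤ J + lam * (F / 2 : ℝ≥0) := by
          rw [RemoteEstimation.lagrangian, ← hJ]
          gcongr
      _ ≤ lam * F := by
          have h4 : J ≤ lam * (F / 2) := by
            rw [hlam, add_mul, div_mul_cancel₀ _ (half_pos hF0).ne']
            exact le_add_of_nonneg_right zero_le
          have h5 : J + lam * (F / 2) ≤ lam * F := by
            calc J + lam * (F / 2) ≤ lam * (F / 2) + lam * (F / 2) := by gcongr
              _ = lam * F := by rw [← mul_add, add_halves]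
          exact_mod_cast h5
  have hlam0 : (lam : ℝ≥0∞) ≠ 0 := by
    exact_mod_cast (add_pos_of_nonneg_of_pos zero_le one_pos : 0 < lam).ne'
  exact (ENNReal.mul_le_mul_iff_right hlam0 ENNReal.coe_ne_top).1 h3
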